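/- Let $P$ be a prime field (that is, $P\cong\mathbb{Q}$ or $P\cong\mathbb{F}_p$ for a prime $p$), let $q\geq 1$ be an integer not divisible by the characteristic of $P$, and let $\theta$ be a primitive $q$-th root of unity in some extension field of $P$. Write $[g,h]=g^{-1}h^{-1}gh$, and let $\Gamma=\langle x,y : [x,[x,y]]=[y,[x,y]]=1\rangle$ be the Heisenberg group. Let $F=P(\theta)(a,b)$ be the rational function field in two commuting indeterminates $a,b$ over $P(\theta)$, and let $\mathcal{S}_F(a,b,\theta)$ be the symbol algebra, i.e. the $F$-algebra generated by $\mathbf{i},\mathbf{j}$ subject to $\mathbf{i}^q=a$, $\mathbf{j}^q=b$, $\mathbf{j}\mathbf{i}=\theta\,\mathbf{i}\mathbf{j}$. Then the group algebra $P[\Gamma]$ has a division ring of fractions $D$ (a division ring containing $P[\Gamma]$ in which every element has the form $rs^{-1}$ with $r,s\in P[\Gamma]$, $s\neq 0$), the algebra $\mathcal{S}_F(a,b,\theta)$ is a division ring, and for every such $D$ there is a specialization $\psi$ from $D$ to $\mathcal{S}_F(a,b,\theta)$ such that $\psi(x)=\mathbf{i}$, $\psi(y)=\mathbf{j}$ and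 $\psi([y,x])=\theta$. Here a specialization from a division ring $D$ to a division ring $E$ is a surjective ring homomorphism $\psi\colon T\to E$ from a subring $T$ of $D$ such that every element of $T$ not in $\ker\psi$ is invertible in $T$; in particular $x$, $y$ and $[y,x]$ belong to $T$. -/

import Mathlib

universe u v w

/-- The commutator with the convention `[g, h] = g⁻¹ h⁻¹ g h`
(Mathlib's `⁅g, h⁆` is `g h g⁻¹ h⁻¹`). -/
def groupComm {G : Type*} [Group G] (g h : G) : G := g⁻¹ * h⁻¹ * g * h

/-- The relators `[x,[x,y]]` and `[y,[x,y]]` in the free group on `x = of 0`, `y = of 1`. -/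
def heisenbergRels : Set (FreeGroup (Fin 2)) :=
  {groupComm (FreeGroup.of 0) (groupComm (FreeGroup.of 0) (FreeGroup.of 1)),
   groupComm (FreeGroup.of 1) (groupComm (FreeGroup.of 0) (FreeGroup.of 1))}

/-- The Heisenberg group `⟨x, y : [x,[x,y]] = [y,[x,y]] = 1⟩`. -/
abbrev HeisenbergGroup : Type := PresentedGroup heisenbergRels

namespace HeisenbergGroup

/-- The generator `x`. -/
def x : HeisenbergGroup := PresentedGroup.of 0

/-- The generator `y`. -/
def y : HeisenbergGroup := PresentedGroup.of 1

end HeisenbergGroup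

/-- The defining relations `i ^ m = a`, `j ^ m = b`, `j i = θ i j` of a symbol algebra, in the
free algebra on `i = ι 0`, `j = ι 1`. -/
inductive SymbolAlgebra.Rel (k : Type*) [CommRing k] (m : ℕ) (a b θ : k) :
    FreeAlgebra k (Fin 2) → FreeAlgebra k (Fin 2) → Prop
  | i_pow : SymbolAlgebra.Rel k m a b θ (FreeAlgebra.ι k 0 ^ m) (algebraMap k _ a)
  | j_pow : SymbolAlgebra.Rel k m a b θ (FreeAlgebra.ι k 1 ^ m) (algebraMap k _ b)
  | j_mul_i : SymbolAlgebra.Rel k m a b θ (FreeAlgebra.ι k 1 * FreeAlgebra.ι k 0)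
      (algebraMap k _ θ * (FreeAlgebra.ι k 0 * FreeAlgebra.ι k 1))

/-- The symbol algebra `S_k(a, b, θ)` of degree `m`: the `k`-algebra generated by `i`, `j`
subject to `i ^ m = a`, `j ^ m = b`, `j i = θ i j`. -/
abbrev SymbolAlgebra (k : Type*) [CommRing k] (m : ℕ) (a b θ : k) : Type _ :=
  RingQuot (SymbolAlgebra.Rel k m a b θ)

namespace SymbolAlgebra

variable {k : Type*} [CommRing k] {m : ℕ} {a b θ : k}

/-- The generator `i`. -/
noncomputable def i : SymbolAlgebra k m a b θ :=
  RingQuot.mkAlgHom k (SymbolAlgebra.Rel k m a b θ) (FreeAlgebra.ι k 0)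

/-- The generator `j`. -/
noncomputable def j : SymbolAlgebra k m a b θ :=
  RingQuot.mkAlgHom k (SymbolAlgebra.Rel k m a b θ) (FreeAlgebra.ι k 1)

end SymbolAlgebra

/-- `ι : A → D` exhibits the division ring `D` as the division ring of (right) fractions of `A`. -/
structure IsDivisionRingOfFractions {A D : Type*} [Ring A] [DivisionRing D] (ι : A →+* D) :
    Prop where
  injective : Function.Injective ι
  exists_eq_mul_inv : ∀ d : D, ∃ r s : A, s ≠ 0 ∧ d = ι r * (ι s)⁻¹

/-- A ring is a division ring: it is nontrivial and every nonzero element is invertible. -/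
structure RingIsDivision (E : Type*) [Ring E] : Prop where
  nontrivial : Nontrivial E
  isUnit_of_ne_zero : ∀ e : E, e ≠ 0 → IsUnit e

/-- A specialization from a division ring `D` to a division ring `E`: a surjective homomorphism
from a subring `T` of `D` onto `E` such that every element of `T` outside of the kernel is
invertible in `T`. -/
structure RingSpecialization (D E : Type*) [DivisionRing D] [Ring E] where
  target_division : RingIsDivision E
  domain : Subring D
  toHom : domain →+* E
  surjective : Function.Surjective toHom
  isUnit_of_notMem_ker : ∀ t : domain, t ∉ RingHom.ker toHom → IsUnit t

/-- `ψ` is defined at `d` and takes the value `e` there. -/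
def RingSpecialization.MapsTo {D E : Type*} [DivisionRing D] [Ring E] (ψ : RingSpecialization D E)
    (d : D) (e : E) : Prop :=
  ∃ h : d ∈ ψ.domain, ψ.toHom ⟨d, h⟩ = e

/-- The rational function field `K(a, b)` in two commuting indeterminates over `K`. -/
abbrev RatFunc₂ (K : Type*) [Field K] : Type _ := FractionRing (MvPolynomial (Fin 2) K)

namespace RatFunc₂

variable (K : Type*) [Field K]

/-- The indeterminate `a`. -/
noncomputable def a : RatFunc₂ K := algebraMap (MvPolynomial (Fin 2) K) _ (MvPolynomial.X 0)

/-- The indeterminate `b`. -/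
noncomputable def b : RatFunc₂ K := algebraMap (MvPolynomial (Fin 2) K) _ (MvPolynomial.X 1)

end RatFunc₂

/-- For `θ` in an extension `L` of `P`: the element `θ` of `F = P(θ)(a, b)`. -/
noncomputable def rootInRatFunc₂ (P : Type*) {L : Type*} [Field P] [Field L] [Algebra P L]
    (θ : L) : RatFunc₂ (IntermediateField.adjoin P {θ}) :=
  algebraMap (IntermediateField.adjoin P {θ}) _ (IntermediateField.AdjoinSimple.gen P θ)

/-- The symbol algebra `S_F(a, b, θ)` of degree `q` over `F = P(θ)(a, b)`. -/
abbrev GenericSymbolAlgebra (P : Type*) {L : Type*} [Field P] [Field L] [Algebra P L]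
    (q : ℕ) (θ : L) : Type _ :=
  SymbolAlgebra (RatFunc₂ (IntermediateField.adjoin P {θ})) q
    (RatFunc₂.a _) (RatFunc₂.b _) (rootInRatFunc₂ P θ)

/-! The element c = [y, x] is central in Γ, so, up to unit factors from Γ, every element of P[Γ] is
a sum of terms w(c) x^m y^n with w a polynomial and m, n natural numbers. Let φ be the homomorphism
from P[Γ] to the symbol algebra sending x, y, c to i, j, θ. Since a = i^q and b = j^q are
indeterminates, the monomials i^m j^n with m, n natural are linearly independent over the constants
P(θ) (`Generic.skewEval_injective`). Hence ker φ is generated by the single central element π =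
μ(c), where μ is the minimal polynomial of θ, and every nonzero s is s' π^n with φ(s') ≠ 0.

Common powers of π can therefore be cancelled from a fraction until numerator and denominator are
not both in ker φ (`exists_reduced`). This yields the Ore condition for the complement of ker φ
(`exists_ore`), so the fractions r s⁻¹ with φ(s) ≠ 0 form a subring T of D, on which r s⁻¹ ↦ φ(r)
φ(s)⁻¹ is the specialization. It is surjective because i, j and θ generate the symbol algebra under
ring operations and inverses.

The symbol algebra is a domain: clearing denominators from F leaves skew polynomials over P(θ),
whose products are controlled by an exponent attained only once. Being finite-dimensional over F, it
is a division ring. For the existence of D, integer coordinates give Γ a left-invariant order, so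
P[Γ] is a domain, and boxes that grow little under translation give the Ore condition by counting
dimensions. -/

/-! ### Skew polynomial sums in two elements with t s = θ s t -/

/-- The sum `∑ κ (w (m, n)) * s ^ m * t ^ n` attached to a finitely supported family of
coefficients `w`. -/
noncomputable def skewEval {A B : Type*} [CommRing A] [Ring B] (κ : A →+* B) (s t : B) :
    (ℕ × ℕ →₀ A) →+ B :=
  Finsupp.liftAddHom fun p => (AddMonoidHom.mulRight (s ^ p.1 * t ^ p.2)).comp κ.toAddMonoidHom

section SkewEval

variable {A B : Type*} [CommRing A] [Ring B] (κ : A →+* B) (s t : B)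

theorem skewEval_apply (w : ℕ × ℕ →₀ A) :
    skewEval κ s t w = w.sum fun p k => κ k * (s ^ p.1 * t ^ p.2) := rfl

theorem skewEval_single (p : ℕ × ℕ) (k : A) :
    skewEval κ s t (Finsupp.single p k) = κ k * (s ^ p.1 * t ^ p.2) := by
  simp [skewEval]

theorem skewEval_smul (k : A) (w : ℕ × ℕ →₀ A) :
    skewEval κ s t (k • w) = κ k * skewEval κ s t w := by
  induction w using Finsupp.induction_linear with
  | zero => simp
  | add f g hf hg => rw [smul_add, map_add, hf, hg, map_add, mul_add]
  | single p a =>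
    rw [Finsupp.smul_single, skewEval_single, skewEval_single, smul_eq_mul, map_mul, mul_assoc]

theorem map_skewEval {A' B' : Type*} [CommRing A'] [Ring B'] (κ' : A' →+* B')
    (f : A →+* A') (φ : B →+* B') (h : ∀ k, φ (κ k) = κ' (f k)) (w : ℕ × ℕ →₀ A) :
    φ (skewEval κ s t w) =
      skewEval κ' (φ s) (φ t) (w.mapRange f (map_zero f)) := by
  induction w using Finsupp.induction_linear with
  | zero => simp
  | add x y hx hy =>
    rw [map_add, map_add, hx, hy, Finsupp.mapRange_add (fun a b => map_add f a b), map_add]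
  | single p a => simp [skewEval_single, h]

theorem pow_mul_pow_of_mul_eq {θ : A} (hκ : ∀ k b, κ k * b = b * κ k)
    (hts : t * s = κ θ * (s * t)) (m n : ℕ) :
    t ^ n * s ^ m = κ (θ ^ (n * m)) * (s ^ m * t ^ n) := by
  have h1 : ∀ m, t * s ^ m = κ (θ ^ m) * (s ^ m * t) := by
    intro m
    induction m with
    | zero => simp
    | succ m ih =>
      rw [pow_succ, ← mul_assoc, ih, mul_assoc, mul_assoc, hts, ← mul_assoc (s ^ m), ← hκ,
        pow_succ θ, map_mul]
      simp only [mul_assoc]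
  induction n with
  | zero => simp
  | succ n ih =>
    rw [pow_succ, mul_assoc, h1, ← mul_assoc, ← hκ, mul_assoc, ← mul_assoc (t ^ n), ih,
      Nat.succ_mul, add_comm, pow_add, map_mul]
    simp only [mul_assoc]

theorem skewEval_mul_skewEval {θ : A} (hκ : ∀ k b, κ k * b = b * κ k)
    (hts : t * s = κ θ * (s * t)) (w w' : ℕ × ℕ →₀ A) :
    skewEval κ s t w * skewEval κ s t w' =
      skewEval κ s t (∑ a ∈ w.support, ∑ b ∈ w'.support,
        Finsupp.single (a + b) (w a * w' b * θ ^ (a.2 * b.1))) := by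
  rw [skewEval_apply κ s t w, skewEval_apply κ s t w', Finsupp.sum, Finsupp.sum,
    Finset.sum_mul_sum, map_sum]
  refine Finset.sum_congr rfl fun a _ => ?_
  rw [map_sum]
  refine Finset.sum_congr rfl fun b _ => ?_
  have e := pow_mul_pow_of_mul_eq κ s t hκ hts b.1 a.2
  rw [skewEval_single, Prod.fst_add, Prod.snd_add, pow_add, pow_add, map_mul, map_mul]
  symm
  calc κ (w a) * κ (w' b) * κ (θ ^ (a.2 * b.1)) * (s ^ a.1 * s ^ b.1 * (t ^ a.2 * t ^ b.2))
      = κ (w a) * κ (w' b) * s ^ a.1 * (κ (θ ^ (a.2 * b.1)) * (s ^ b.1 * t ^ a.2)) * t ^ b.2 := by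
        rw [mul_assoc (κ (w a) * κ (w' b)), ← mul_assoc (κ (θ ^ _)), ← mul_assoc (κ (θ ^ _)),
          hκ _ (s ^ a.1)]
        simp only [mul_assoc]
    _ = κ (w a) * (κ (w' b) * (s ^ a.1 * t ^ a.2)) * (s ^ b.1 * t ^ b.2) := by
        rw [← e]; simp only [mul_assoc]
    _ = _ := by rw [hκ (w' b)]; simp only [mul_assoc]

theorem exists_skewEval_eq_mul {θ : A} (hκ : ∀ k b, κ k * b = b * κ k)
    (hts : t * s = κ θ * (s * t)) (w w' : ℕ × ℕ →₀ A) :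
    ∃ z, skewEval κ s t z = skewEval κ s t w * skewEval κ s t w' :=
  ⟨_, (skewEval_mul_skewEval κ s t hκ hts w w').symm⟩

/-- The supports contain exponents p and q whose sum is attained by no other pair; the coefficient
of the product at p + q is then a single product of nonzero factors. -/
theorem eq_zero_or_eq_zero_of_skewEval_mul_eq_zero [IsDomain A] {θ : A} (hθ : θ ≠ 0)
    (hκ : ∀ k b, κ k * b = b * κ k) (hts : t * s = κ θ * (s * t))
    (hinj : Function.Injective (skewEval κ s t)) {w w' : ℕ × ℕ →₀ A}
    (h : skewEval κ s t w * skewEval κ s t w' = 0) : w = 0 ∨ w' = 0 := by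
  classical
  by_contra! hne
  obtain ⟨p, hp, q, hq, hpq⟩ := UniqueSums.uniqueAdd_of_nonempty
    (Finsupp.support_nonempty_iff.2 hne.1) (Finsupp.support_nonempty_iff.2 hne.2)
  rw [skewEval_mul_skewEval κ s t hκ hts] at h
  have h0 := hinj (h.trans (map_zero _).symm)
  have h1 := DFunLike.congr_fun h0 (p + q)
  simp only [Finsupp.coe_zero, Pi.zero_apply, Finsupp.finsetSum_apply, Finsupp.single_apply] at h1
  rw [Finset.sum_eq_single p, Finset.sum_eq_single q] at h1
  · simp only [if_true] at h1
    simp only [Finsupp.mem_support_iff] at hp hq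
    exact mul_ne_zero (mul_ne_zero hp hq) (pow_ne_zero _ hθ) h1
  · intro b hb hbq
    exact if_neg fun e => hbq (hpq hp hb e).2
  · exact fun hn => absurd hq hn
  · intro a ha hap
    refine Finset.sum_eq_zero fun b hb => if_neg fun e => hap (hpq ha hb e).1
  · exact fun hn => absurd hp hn

end SkewEval

/-! ### Symbol algebras over a commutative ring -/

namespace SymbolAlgebra

section Basic

variable {k : Type*} [CommRing k] {m : ℕ} {a b θ : k}

theorem i_pow_eq : (i : SymbolAlgebra k m a b θ) ^ m = algebraMap k _ a := by
  rw [i, ← map_pow, RingQuot.mkAlgHom_rel k Rel.i_pow, AlgHom.commutes]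

theorem j_pow_eq : (j : SymbolAlgebra k m a b θ) ^ m = algebraMap k _ b := by
  rw [j, ← map_pow, RingQuot.mkAlgHom_rel k Rel.j_pow, AlgHom.commutes]

theorem j_mul_i_eq : (j : SymbolAlgebra k m a b θ) * i = algebraMap k _ θ * (i * j) := by
  rw [i, j, ← map_mul, RingQuot.mkAlgHom_rel k Rel.j_mul_i, map_mul, AlgHom.commutes, map_mul]

theorem induction {C : SymbolAlgebra k m a b θ → Prop} (scalar : ∀ c, C (algebraMap k _ c))
    (hi : C i) (hj : C j) (add : ∀ s t, C s → C t → C (s + t))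
    (mul : ∀ s t, C s → C t → C (s * t)) (s : SymbolAlgebra k m a b θ) : C s := by
  obtain ⟨s, rfl⟩ := RingQuot.mkAlgHom_surjective k (Rel k m a b θ) s
  induction s using FreeAlgebra.induction with
  | grade0 r => rw [AlgHom.commutes]; exact scalar r
  | grade1 x => fin_cases x; exacts [hi, hj]
  | mul s t hs ht => rw [map_mul]; exact mul _ _ hs ht
  | add s t hs ht => rw [map_add]; exact add _ _ hs ht

/-- A field extension `σ : k → M` with `m`-th roots `α`, `β` of `a`, `b` and a `k`-automorphism
`τ` with `τ α = θ α`, `τ β = β` is a module over the symbol algebra, on which `i ^ r * j ^ s`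
sends `1` to `α ^ r * β ^ s`. -/
theorem skewEval_eq_zero_of_rep {A M : Type*} [CommRing A] [CommRing M] (f : A →+* k)
    (σ : k →+* M) (τ : M →+* M) {α β : M} (hτσ : ∀ c, τ (σ c) = σ c) (hα : α ^ m = σ a)
    (hβ : β ^ m = σ b) (hτα : τ α = σ θ * α) (hτβ : τ β = β) (hτm : ∀ v, τ^[m] v = v)
    {w : ℕ × ℕ →₀ A}
    (h : skewEval ((algebraMap k (SymbolAlgebra k m a b θ)).comp f) i j w = 0) :
    skewEval (σ.comp f) α β w = 0 := by
  let _ := σ.toAlgebra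
  let τ' : M →ₐ[k] M := { τ with commutes' := hτσ }
  let I : Module.End k M := LinearMap.mulLeft k α
  let J : Module.End k M := LinearMap.mulLeft k β * τ'.toLinearMap
  have hI (v) : I v = α * v := rfl
  have hJ (v) : J v = β * τ v := rfl
  have hIp (n : ℕ) (v) : (I ^ n) v = α ^ n * v := by
    induction n with
    | zero => simp
    | succ n ih => rw [pow_succ', Module.End.mul_apply, ih, hI, pow_succ', mul_assoc]
  have hJp (n : ℕ) (v) : (J ^ n) v = β ^ n * τ^[n] v := by
    induction n with
    | zero => simp
    | succ n ih =>
      rw [pow_succ', Module.End.mul_apply, ih, hJ, map_mul, map_pow, hτβ, pow_succ', mul_assoc,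
        Function.iterate_succ_apply']
  have hrel ⦃x y⦄ (hxy : Rel k m a b θ x y) :
      FreeAlgebra.lift k ![I, J] x = FreeAlgebra.lift k ![I, J] y := by
    cases hxy with
    | i_pow =>
      ext v
      simp only [map_pow, FreeAlgebra.lift_ι_apply, AlgHom.commutes, Matrix.cons_val_zero, hIp, hα]
      rfl
    | j_pow =>
      ext v
      simp only [map_pow, FreeAlgebra.lift_ι_apply, AlgHom.commutes, Matrix.cons_val_one,
        Matrix.cons_val_zero, hJp, hβ, hτm]
      rfl
    | j_mul_i =>
      ext v
      simp only [map_mul, FreeAlgebra.lift_ι_apply, AlgHom.commutes, Matrix.cons_val_one,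
        Matrix.cons_val_zero, Module.End.mul_apply, hI, hJ, hτα]
      change _ = σ θ * (α * (β * τ v))
      ring
  let ρ : SymbolAlgebra k m a b θ →ₐ[k] Module.End k M := RingQuot.liftAlgHom k ⟨_, hrel⟩
  have hρi : ρ i = I := by simp [ρ, i]
  have hρj : ρ j = J := by simp [ρ, j]
  have key (w : ℕ × ℕ →₀ A) :
      ρ (skewEval ((algebraMap k (SymbolAlgebra k m a b θ)).comp f) i j w) 1 =
        skewEval (σ.comp f) α β w := by
    induction w using Finsupp.induction_linear with
    | zero => simp
    | add x y hx hy => rw [map_add, map_add, map_add, LinearMap.add_apply, hx, hy]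
    | single p c =>
      rw [skewEval_single, skewEval_single, map_mul, map_mul, map_pow, map_pow, hρi, hρj,
        Module.End.mul_apply, Module.End.mul_apply, hJp, hIp, RingHom.comp_apply, AlgHom.commutes,
        iterate_map_one, mul_one]
      rfl
  rw [← key, h, map_zero, LinearMap.zero_apply]

theorem isUnit_i (hm : m ≠ 0) (ha : IsUnit a) : IsUnit (i : SymbolAlgebra k m a b θ) :=
  (isUnit_pow_iff hm).1 (i_pow_eq (θ := θ) ▸ ha.map (algebraMap k _))

theorem isUnit_j (hm : m ≠ 0) (hb : IsUnit b) : IsUnit (j : SymbolAlgebra k m a b θ) :=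
  (isUnit_pow_iff hm).1 (j_pow_eq (θ := θ) ▸ hb.map (algebraMap k _))

theorem skewEval_surjective :
    Function.Surjective (skewEval (algebraMap k (SymbolAlgebra k m a b θ)) i j) := by
  have hk (c : k) (s : SymbolAlgebra k m a b θ) := Algebra.commutes c s
  intro s
  induction s using SymbolAlgebra.induction with
  | scalar c => exact ⟨Finsupp.single 0 c, by simp [skewEval_single]⟩
  | hi => exact ⟨Finsupp.single (1, 0) 1, by simp [skewEval_single]⟩
  | hj => exact ⟨Finsupp.single (0, 1) 1, by simp [skewEval_single]⟩
  | add s t hs ht =>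
    obtain ⟨v, rfl⟩ := hs
    obtain ⟨w, rfl⟩ := ht
    exact ⟨v + w, map_add _ _ _⟩
  | mul s t hs ht =>
    obtain ⟨v, rfl⟩ := hs
    obtain ⟨w, rfl⟩ := ht
    exact exists_skewEval_eq_mul _ _ _ hk j_mul_i_eq v w

theorem finite (hm : m ≠ 0) : Module.Finite k (SymbolAlgebra k m a b θ) := by
  classical
  refine ⟨⟨(Finset.range m ×ˢ Finset.range m).image fun p : ℕ × ℕ => i ^ p.1 * j ^ p.2, ?_⟩⟩
  rw [eq_top_iff]
  rintro s -
  obtain ⟨w, rfl⟩ := skewEval_surjective s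
  rw [skewEval_apply]
  refine Submodule.sum_mem _ fun p _ => ?_
  dsimp only
  rw [← Algebra.smul_def]
  refine Submodule.smul_mem _ _ ?_
  -- Division of the exponents by m turns full m-th powers into scalars, leaving exponents below m.
  have e : (i : SymbolAlgebra k m a b θ) ^ p.1 * j ^ p.2 =
      (a ^ (p.1 / m) * b ^ (p.2 / m)) • (i ^ (p.1 % m) * j ^ (p.2 % m)) := by
    conv_lhs => rw [← Nat.div_add_mod p.1 m, ← Nat.div_add_mod p.2 m]
    rw [pow_add, pow_add, pow_mul, pow_mul, i_pow_eq, j_pow_eq, ← map_pow, ← map_pow,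
      ← Algebra.smul_def, ← Algebra.smul_def, smul_mul_smul_comm]
  rw [e]
  refine Submodule.smul_mem _ _ (Submodule.subset_span ?_)
  rw [Finset.coe_image]
  refine ⟨(p.1 % m, p.2 % m), ?_, rfl⟩
  simp [Nat.mod_lt _ (Nat.pos_of_ne_zero hm)]

end Basic

end SymbolAlgebra

/-! ### Rational functions in two variables and their endomorphisms -/

namespace RatFunc₂

variable {K : Type*} [Field K]

theorem algebraMap_C (c : K) :
    algebraMap (MvPolynomial (Fin 2) K) (RatFunc₂ K) (MvPolynomial.C c) = algebraMap K _ c := by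
  rw [← MvPolynomial.algebraMap_eq, ← IsScalarTower.algebraMap_apply]

theorem ringHom_ext {M : Type*} [Field M] {f g : RatFunc₂ K →+* M}
    (hK : ∀ c : K, f (algebraMap K _ c) = g (algebraMap K _ c))
    (ha : f (a K) = g (a K)) (hb : f (b K) = g (b K)) : f = g := by
  refine IsLocalization.ringHom_ext (nonZeroDivisors (MvPolynomial (Fin 2) K)) ?_
  refine MvPolynomial.ringHom_ext (fun c => ?_) fun n => ?_
  · rw [RingHom.comp_apply, RingHom.comp_apply, algebraMap_C, hK]
  · fin_cases n
    exacts [ha, hb]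

theorem skewEval_injective :
    Function.Injective (skewEval (algebraMap K (RatFunc₂ K)) (a K) (b K)) := by
  let e : ℕ × ℕ → (Fin 2 →₀ ℕ) := fun p => Finsupp.single 0 p.1 + Finsupp.single 1 p.2
  have he : Function.Injective e := by
    rintro ⟨m, n⟩ ⟨m', n'⟩ h
    have h0 := DFunLike.congr_fun h 0
    have h1 := DFunLike.congr_fun h 1
    simp [e] at h0 h1
    rw [h0, h1]
  have hc (w : ℕ × ℕ →₀ K) (p : ℕ × ℕ) : MvPolynomial.coeff (e p)
      (skewEval MvPolynomial.C (MvPolynomial.X 0) (MvPolynomial.X 1) w) = w p := by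
    induction w using Finsupp.induction_linear with
    | zero => simp
    | add x y hx hy => rw [map_add, MvPolynomial.coeff_add, hx, hy, Finsupp.add_apply]
    | single r c =>
      have : MvPolynomial.C c * (MvPolynomial.X 0 ^ r.1 * MvPolynomial.X 1 ^ r.2) =
          MvPolynomial.monomial (e r) c := by
        rw [MvPolynomial.X_pow_eq_monomial, MvPolynomial.X_pow_eq_monomial,
          MvPolynomial.monomial_mul, MvPolynomial.C_mul_monomial, mul_one, mul_one]
      rw [skewEval_single, this, MvPolynomial.coeff_monomial, Finsupp.single_apply]
      simp only [he.eq_iff]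
  intro w w' h
  have hm (w : ℕ × ℕ →₀ K) : skewEval (algebraMap K (RatFunc₂ K)) (a K) (b K) w =
      algebraMap (MvPolynomial (Fin 2) K) _
        (skewEval MvPolynomial.C (MvPolynomial.X 0) (MvPolynomial.X 1) w) := by
    rw [map_skewEval _ _ _ (algebraMap K (RatFunc₂ K)) (RingHom.id K)]
    · simp [a, b]
    · exact algebraMap_C
  rw [hm, hm] at h
  have h := IsFractionRing.injective _ _ h
  ext p
  rw [← hc w, h, hc]

/-- Through σ the field K(a, b) becomes an extension of itself in which a and b are q-th roots of
the old indeterminates; τ fixes the image of σ because ζ^q = 1. These are the data required by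
`skewEval_eq_zero_of_rep`. -/
theorem exists_endomorphisms {q : ℕ} (hq : q ≠ 0) {ζ : K} (hζ : ζ ^ q = 1) :
    ∃ σ τ : RatFunc₂ K →+* RatFunc₂ K,
      (∀ c, σ (algebraMap K _ c) = algebraMap K _ c) ∧ σ (a K) = a K ^ q ∧ σ (b K) = b K ^ q ∧
      τ (a K) = algebraMap K _ ζ * a K ∧ τ (b K) = b K ∧ (∀ v, τ^[q] v = v) ∧
      ∀ c, τ (σ c) = σ c := by
  have hC (c : K) : algebraMap K (RatFunc₂ K) c =
      algebraMap (MvPolynomial (Fin 2) K) _ (MvPolynomial.C c) := (algebraMap_C c).symm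
  let σ₀ : MvPolynomial (Fin 2) K →+* MvPolynomial (Fin 2) K :=
    (MvPolynomial.expand q : MvPolynomial (Fin 2) K →ₐ[K] MvPolynomial (Fin 2) K)
  have hσ₀ : Function.Injective σ₀ := MvPolynomial.expand_injective (Nat.pos_of_ne_zero hq)
  let τ₀ : MvPolynomial (Fin 2) K →+* MvPolynomial (Fin 2) K :=
    (MvPolynomial.aeval ![MvPolynomial.C ζ * MvPolynomial.X 0, MvPolynomial.X 1] :
      MvPolynomial (Fin 2) K →ₐ[K] MvPolynomial (Fin 2) K)
  have hτC (c : K) : τ₀ (MvPolynomial.C c) = MvPolynomial.C c := by simp [τ₀]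
  have hτX0 : τ₀ (MvPolynomial.X 0) = MvPolynomial.C ζ * MvPolynomial.X 0 := by simp [τ₀]
  have hτX1 : τ₀ (MvPolynomial.X 1) = MvPolynomial.X 1 := by simp [τ₀]
  have hpow (n : ℕ) : (τ₀ ^ n) (MvPolynomial.X 0) = MvPolynomial.C (ζ ^ n) * MvPolynomial.X 0 := by
    induction n with
    | zero => simp
    | succ n ih =>
      rw [pow_succ', RingHom.mul_def, RingHom.comp_apply, ih, map_mul, hτC, hτX0, ← mul_assoc,
        ← map_mul, pow_succ]
  have hτq : τ₀ ^ q = 1 := by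
    refine MvPolynomial.ringHom_ext (fun c => ?_) fun n => ?_
    · rw [RingHom.coe_pow, Function.iterate_fixed (hτC c)]; rfl
    · fin_cases n
      · change (τ₀ ^ q) (MvPolynomial.X 0) = MvPolynomial.X 0
        rw [hpow, hζ, map_one, one_mul]
      · change (τ₀ ^ q) (MvPolynomial.X 1) = MvPolynomial.X 1
        rw [RingHom.coe_pow, Function.iterate_fixed hτX1]
  -- Finite order gives the injectivity needed to extend τ₀ to the fraction field.
  have hτ₀ : Function.Injective τ₀ := by
    have h : Function.Injective (τ₀^[q]) := by
      rw [← RingHom.coe_pow, hτq]; exact Function.injective_id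
    obtain ⟨n, rfl⟩ := Nat.exists_eq_succ_of_ne_zero hq
    rw [Function.iterate_succ] at h
    exact h.of_comp
  let σ : RatFunc₂ K →+* RatFunc₂ K := IsFractionRing.map hσ₀
  let τ : RatFunc₂ K →+* RatFunc₂ K := IsFractionRing.map hτ₀
  have hσ (p) : σ (algebraMap (MvPolynomial (Fin 2) K) _ p) = algebraMap _ _ (σ₀ p) :=
    IsLocalization.map_eq _ _
  have hτ (p) : τ (algebraMap (MvPolynomial (Fin 2) K) _ p) = algebraMap _ _ (τ₀ p) :=
    IsLocalization.map_eq _ _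
  have hσK (c) : σ (algebraMap K _ c) = algebraMap K _ c := by
    rw [hC, hσ]; simp [σ₀]
  have hτK (c) : τ (algebraMap K _ c) = algebraMap K _ c := by
    rw [hC, hτ, hτC]
  have hσa : σ (a K) = a K ^ q := by rw [a, hσ, ← map_pow]; simp [σ₀]
  have hσb : σ (b K) = b K ^ q := by rw [b, hσ, ← map_pow]; simp [σ₀]
  have hτa : τ (a K) = algebraMap K _ ζ * a K := by rw [a, hτ, hτX0, map_mul, hC]
  have hτb : τ (b K) = b K := by rw [b, hτ, hτX1]
  have hpow' (n : ℕ) : (τ ^ n) (a K) = algebraMap K _ (ζ ^ n) * a K := by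
    induction n with
    | zero => simp
    | succ n ih =>
      rw [pow_succ', RingHom.mul_def, RingHom.comp_apply, ih, map_mul, hτK, hτa, ← mul_assoc,
        ← map_mul, pow_succ]
  have hτq' : τ ^ q = RingHom.id _ := by
    refine ringHom_ext (fun c => ?_) ?_ ?_
    · rw [RingHom.coe_pow, Function.iterate_fixed (hτK c)]; rfl
    · rw [hpow', hζ, map_one, one_mul]; rfl
    · rw [RingHom.coe_pow, Function.iterate_fixed hτb]; rfl
  have hτσ : τ.comp σ = σ := by
    refine ringHom_ext (fun c => ?_) ?_ ?_
    · rw [RingHom.comp_apply, hσK, hτK]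
    · rw [RingHom.comp_apply, hσa, map_pow, hτa, mul_pow, ← map_pow, hζ, map_one, one_mul]
    · rw [RingHom.comp_apply, hσb, map_pow, hτb]
  refine ⟨σ, τ, hσK, hσa, hσb, hτa, hτb, fun v => ?_, fun c => RingHom.congr_fun hτσ c⟩
  rw [← RingHom.coe_pow, hτq']; rfl

end RatFunc₂

/-! ### The generic symbol algebra is a division ring -/

namespace SymbolAlgebra

section Generic

variable {K : Type*} [Field K] {q : ℕ} {ζ : K}

/-- The symbol algebra of degree `q` over `K(a, b)` with parameters `a`, `b`, `ζ`. -/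
abbrev Generic (K : Type*) [Field K] (q : ℕ) (ζ : K) : Type _ :=
  SymbolAlgebra (RatFunc₂ K) q (RatFunc₂.a K) (RatFunc₂.b K) (algebraMap K _ ζ)

/-- The inclusion of the constants into the generic symbol algebra. -/
noncomputable def Generic.const (K : Type*) [Field K] (q : ℕ) (ζ : K) : K →+* Generic K q ζ :=
  (algebraMap (RatFunc₂ K) (Generic K q ζ)).comp (algebraMap K (RatFunc₂ K))

theorem Generic.const_mul_comm (c : K) (s : Generic K q ζ) :
    Generic.const K q ζ c * s = s * Generic.const K q ζ c :=
  Algebra.commutes _ s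

theorem Generic.j_mul_i : (j : Generic K q ζ) * i = Generic.const K q ζ ζ * (i * j) :=
  j_mul_i_eq

/-- In the representation on K(a, b), applying the sum to 1 gives the commutative polynomial with
the same coefficients, since σ fixes constants. Coefficients must be constants here: over F the
relation i^q = a is a dependence. -/
theorem Generic.skewEval_injective (hq : q ≠ 0) (hζ : ζ ^ q = 1) :
    Function.Injective (skewEval (Generic.const K q ζ) i j) := by
  obtain ⟨σ, τ, hσK, hσa, hσb, hτa, hτb, hτq, hτσ⟩ := RatFunc₂.exists_endomorphisms hq hζ
  refine (injective_iff_map_eq_zero _).2 fun w hw => ?_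
  have h := skewEval_eq_zero_of_rep (algebraMap K (RatFunc₂ K)) σ τ hτσ hσa.symm hσb.symm
    (by rw [hτa, hσK]) hτb hτq hw
  have e : σ.comp (algebraMap K (RatFunc₂ K)) = algebraMap K (RatFunc₂ K) := RingHom.ext hσK
  rw [e] at h
  exact RatFunc₂.skewEval_injective (h.trans (map_zero _).symm)

theorem Generic.exists_skewEval_eq_algebraMap (p : MvPolynomial (Fin 2) K) :
    ∃ w, skewEval (Generic.const K q ζ) i j w =
      algebraMap (RatFunc₂ K) (Generic K q ζ) (algebraMap _ _ p) := by
  induction p using MvPolynomial.induction_on with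
  | C c =>
    refine ⟨Finsupp.single 0 c, ?_⟩
    rw [skewEval_single, RatFunc₂.algebraMap_C, Prod.fst_zero, Prod.snd_zero, pow_zero, pow_zero,
      mul_one, mul_one]
    rfl
  | add p r hp hr =>
    obtain ⟨v, hv⟩ := hp
    obtain ⟨w, hw⟩ := hr
    exact ⟨v + w, by rw [map_add, map_add, map_add, hv, hw]⟩
  | mul_X p n hp =>
    obtain ⟨v, hv⟩ := hp
    obtain ⟨w, hw⟩ : ∃ w, skewEval (Generic.const K q ζ) i j w =
        algebraMap (RatFunc₂ K) (Generic K q ζ) (algebraMap _ _ (MvPolynomial.X n)) := by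
      fin_cases n
      · refine ⟨Finsupp.single (q, 0) 1, ?_⟩
        rw [skewEval_single, i_pow_eq, map_one, one_mul, pow_zero, mul_one]
        rfl
      · refine ⟨Finsupp.single (0, q) 1, ?_⟩
        rw [skewEval_single, j_pow_eq, map_one, one_mul, pow_zero, one_mul]
        rfl
    obtain ⟨z, hz⟩ := exists_skewEval_eq_mul _ i j Generic.const_mul_comm
      (Generic.j_mul_i (q := q) (ζ := ζ)) v w
    exact ⟨z, by rw [hz, hv, hw, map_mul, map_mul]⟩

/-- Clearing of denominators: polynomials in a, b are themselves sums in i, j with constant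
coefficients, via a = i^q and b = j^q. -/
theorem Generic.exists_skewEval_eq_mul_self (s : Generic K q ζ) :
    ∃ p : MvPolynomial (Fin 2) K, p ≠ 0 ∧ ∃ w, skewEval (Generic.const K q ζ) i j w =
      algebraMap (RatFunc₂ K) (Generic K q ζ) (algebraMap _ _ p) * s := by
  have hmul := exists_skewEval_eq_mul _ i j Generic.const_mul_comm
    (Generic.j_mul_i (K := K) (q := q) (ζ := ζ))
  obtain ⟨v, rfl⟩ := skewEval_surjective s
  induction v using Finsupp.induction_linear with
  | zero => exact ⟨1, one_ne_zero, 0, by simp⟩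
  | add x y hx hy =>
    obtain ⟨p, hp, w, hw⟩ := hx
    obtain ⟨r, hr, z, hz⟩ := hy
    obtain ⟨wp, hwp⟩ := Generic.exists_skewEval_eq_algebraMap (q := q) (ζ := ζ) p
    obtain ⟨wr, hwr⟩ := Generic.exists_skewEval_eq_algebraMap (q := q) (ζ := ζ) r
    obtain ⟨w₁, hw₁⟩ := hmul wr w
    obtain ⟨w₂, hw₂⟩ := hmul wp z
    refine ⟨p * r, mul_ne_zero hp hr, w₁ + w₂, ?_⟩
    rw [map_add, hw₁, hw₂, hwp, hwr, hw, hz, map_add, mul_add, ← mul_assoc, ← mul_assoc,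
      ← map_mul, ← map_mul, ← map_mul, ← map_mul, mul_comm r p]
  | single n c =>
    obtain ⟨p, r, hr, rfl⟩ := IsFractionRing.div_surjective (A := MvPolynomial (Fin 2) K) c
    have hr0 := nonZeroDivisors.ne_zero hr
    obtain ⟨wp, hwp⟩ := Generic.exists_skewEval_eq_algebraMap (q := q) (ζ := ζ) p
    obtain ⟨z, hz⟩ := hmul wp (Finsupp.single n 1)
    refine ⟨r, hr0, z, ?_⟩
    have : algebraMap (MvPolynomial (Fin 2) K) (RatFunc₂ K) r ≠ 0 := by simpa using hr0
    rw [hz, hwp, skewEval_single, skewEval_single, map_one, one_mul,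
      ← mul_assoc (algebraMap _ _ (algebraMap _ _ r)), ← map_mul, mul_div_cancel₀ _ this]

theorem Generic.isDomain (hq : q ≠ 0) (hζ : ζ ^ q = 1) : IsDomain (Generic K q ζ) := by
  have hinj := Generic.skewEval_injective hq hζ
  have : Nontrivial (Generic K q ζ) := by
    refine ⟨1, 0, fun h => ?_⟩
    have : (Finsupp.single 0 1 : ℕ × ℕ →₀ K) = 0 := by
      apply hinj
      rw [skewEval_single, map_zero]
      simpa using h
    simp at this
  have hζ0 : ζ ≠ 0 := by
    rintro rfl
    simp [hq] at hζ
  have hz {s : Generic K q ζ} {p : MvPolynomial (Fin 2) K} (hp : p ≠ 0)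
      (h : 0 = algebraMap (RatFunc₂ K) (Generic K q ζ) (algebraMap _ _ p) * s) : s = 0 := by
    have hu : IsUnit (algebraMap (MvPolynomial (Fin 2) K) (RatFunc₂ K) p) :=
      isUnit_iff_ne_zero.2 (by simpa using hp)
    exact (hu.map (algebraMap _ (Generic K q ζ))).mul_right_eq_zero.1 h.symm
  have : NoZeroDivisors (Generic K q ζ) := by
    refine ⟨fun {s t} hst => ?_⟩
    obtain ⟨p, hp, w, hw⟩ := Generic.exists_skewEval_eq_mul_self s
    obtain ⟨r, hr, z, hz'⟩ := Generic.exists_skewEval_eq_mul_self t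
    have h0 : skewEval (Generic.const K q ζ) i j w * skewEval (Generic.const K q ζ) i j z = 0 := by
      rw [hw, hz', mul_assoc, Algebra.left_comm, hst, mul_zero, mul_zero]
    rcases eq_zero_or_eq_zero_of_skewEval_mul_eq_zero _ _ _ hζ0 Generic.const_mul_comm
      Generic.j_mul_i hinj h0 with rfl | rfl
    · exact .inl (hz hp (by rw [← hw, map_zero]))
    · exact .inr (hz hr (by rw [← hz', map_zero]))
  exact NoZeroDivisors.to_isDomain _

theorem Generic.ringIsDivision (hq : q ≠ 0) (hζ : ζ ^ q = 1) :
    RingIsDivision (Generic K q ζ) := by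
  have := Generic.isDomain hq hζ
  have := SymbolAlgebra.finite (k := RatFunc₂ K) (a := RatFunc₂.a K) (b := RatFunc₂.b K)
    (θ := algebraMap K _ ζ) hq
  exact ⟨inferInstance, fun e he => FiniteDimensional.isUnit (RatFunc₂ K) he⟩

end Generic

end SymbolAlgebra

/-! ### Right fractions and the construction of a specialization -/

theorem DivisionRing.mul_inv_mul_mul_inv {D : Type*} [DivisionRing D] {r₁ s₁ r₂ s₂ u v : D}
    (hs₁ : s₁ ≠ 0) (hv : v ≠ 0) (h : r₂ * v = s₁ * u) :
    r₁ * s₁⁻¹ * (r₂ * s₂⁻¹) = r₁ * u * (s₂ * v)⁻¹ := by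
  have : s₁⁻¹ * r₂ = u * v⁻¹ := by
    rw [eq_mul_inv_iff_mul_eq₀ hv, mul_assoc, h, inv_mul_cancel_left₀ hs₁]
  rw [mul_inv_rev, mul_assoc, ← mul_assoc s₁⁻¹, this]
  simp only [mul_assoc]

theorem DivisionRing.mul_inv_add_mul_inv {D : Type*} [DivisionRing D] {r₁ s₁ r₂ s₂ u v : D}
    (hu : u ≠ 0) (hv : v ≠ 0) (h : s₁ * v = s₂ * u) :
    r₁ * s₁⁻¹ + r₂ * s₂⁻¹ = (r₁ * v + r₂ * u) * (s₁ * v)⁻¹ := by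
  rw [add_mul]
  congr 1
  · rw [mul_inv_rev, mul_assoc, mul_inv_cancel_left₀ hv]
  · rw [h, mul_inv_rev, mul_assoc, mul_inv_cancel_left₀ hu]

section Specialization

variable {A D E : Type*} [Ring A] [DivisionRing D] [DivisionRing E] {ι : A →+* D} {φ : A →+* E}

theorem IsDivisionRingOfFractions.exists_reduced (hι : IsDivisionRingOfFractions ι) {π : A}
    (hker : ∀ r, φ r = 0 → ∃ r', r = r' * π)
    (hdiv : ∀ s, s ≠ 0 → ∃ (n : ℕ) (s' : A), φ s' ≠ 0 ∧ s = s' * π ^ n) (d : D) :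
    ∃ r s, s ≠ 0 ∧ (φ r ≠ 0 ∨ φ s ≠ 0) ∧ d = ι r * (ι s)⁻¹ := by
  obtain ⟨r, s, hs, rfl⟩ := hι.exists_eq_mul_inv d
  obtain ⟨n, s', hs', rfl⟩ := hdiv s hs
  -- The induction is on the power of π in the denominator: either the numerator is outside the
  -- kernel, or one factor π cancels on the right.
  induction n generalizing r with
  | zero => exact ⟨r, _, hs, .inr (by simpa using hs'), rfl⟩
  | succ n ih =>
    by_cases hr : φ r = 0
    · obtain ⟨r', rfl⟩ := hker r hr
      rw [pow_succ, ← mul_assoc] at hs ⊢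
      obtain ⟨t, u, hu, h, e⟩ := ih r' (left_ne_zero_of_mul hs)
      refine ⟨t, u, hu, h, ?_⟩
      have hπ0 : π ≠ 0 := right_ne_zero_of_mul hs
      have : ι π ≠ 0 := (map_ne_zero_iff ι hι.injective).2 hπ0
      rw [← e, map_mul ι r', map_mul ι (s' * π ^ n), mul_inv_rev, mul_assoc,
        mul_inv_cancel_left₀ this]
    · exact ⟨r, _, hs, .inl hr, rfl⟩

/-- The left fraction s⁻¹ r is rewritten as a reduced right fraction u v⁻¹. If φ v vanished, then φ
s * φ u = φ r * φ v = 0 would force φ u = 0 as well, against reducedness. -/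
theorem IsDivisionRingOfFractions.exists_ore (hι : IsDivisionRingOfFractions ι)
    (hred : ∀ d : D, ∃ r s, s ≠ 0 ∧ (φ r ≠ 0 ∨ φ s ≠ 0) ∧ d = ι r * (ι s)⁻¹) (r : A) {s : A}
    (hs : φ s ≠ 0) : ∃ u v, φ v ≠ 0 ∧ r * v = s * u := by
  obtain ⟨u, v, hv0, h, e⟩ := hred ((ι s)⁻¹ * ι r)
  have hιs : ι s ≠ 0 := (map_ne_zero_iff ι hι.injective).2 fun h0 => hs (by rw [h0, map_zero])
  have hιv : ι v ≠ 0 := (map_ne_zero_iff ι hι.injective).2 hv0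
  have hrs : r * v = s * u := by
    apply hι.injective
    rw [eq_mul_inv_iff_mul_eq₀ hιv, mul_assoc, inv_mul_eq_iff_eq_mul₀ hιs] at e
    rw [map_mul, map_mul, e]
  refine ⟨u, v, fun hv => ?_, hrs⟩
  have h1 : φ s * φ u = 0 := by rw [← map_mul, ← hrs, map_mul, hv, mul_zero]
  rcases h with h | h
  · exact (mul_ne_zero hs h) h1
  · exact h hv

/-- The graph of the homomorphism `r s⁻¹ ↦ φ r (φ s)⁻¹` on the localization of `A` at the
complement of the kernel of `φ`. -/
def fractionGraph (hι : IsDivisionRingOfFractions ι)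
    (hore : ∀ r s, φ s ≠ 0 → ∃ u v, φ v ≠ 0 ∧ r * v = s * u) : Subring (D × E) where
  carrier := {p | ∃ r s, φ s ≠ 0 ∧ p = (ι r * (ι s)⁻¹, φ r * (φ s)⁻¹)}
  zero_mem' := ⟨0, 1, by simp, Prod.ext (by simp) (by simp)⟩
  one_mem' := ⟨1, 1, by simp, Prod.ext (by simp) (by simp)⟩
  neg_mem' := by
    rintro _ ⟨r, s, hs, rfl⟩
    exact ⟨-r, s, hs, by simp⟩
  mul_mem' := by
    have hne {s : A} (h : φ s ≠ 0) : ι s ≠ 0 :=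
      (map_ne_zero_iff ι hι.injective).2 fun h0 => h (by rw [h0, map_zero])
    rintro _ _ ⟨r₁, s₁, h₁, rfl⟩ ⟨r₂, s₂, h₂, rfl⟩
    obtain ⟨u, v, hv, e⟩ := hore r₂ s₁ h₁
    refine ⟨r₁ * u, s₂ * v, by rw [map_mul]; exact mul_ne_zero h₂ hv, ?_⟩
    simp only [Prod.mk_mul_mk, map_mul]
    rw [DivisionRing.mul_inv_mul_mul_inv (hne h₁) (hne hv) (by rw [← map_mul, e, map_mul]),
      DivisionRing.mul_inv_mul_mul_inv h₁ hv (by rw [← map_mul, e, map_mul])]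
  add_mem' := by
    have hne {s : A} (h : φ s ≠ 0) : ι s ≠ 0 :=
      (map_ne_zero_iff ι hι.injective).2 fun h0 => h (by rw [h0, map_zero])
    rintro _ _ ⟨r₁, s₁, h₁, rfl⟩ ⟨r₂, s₂, h₂, rfl⟩
    obtain ⟨u, v, hv, e⟩ := hore s₁ s₂ h₂
    have hsv : φ (s₁ * v) ≠ 0 := by rw [map_mul]; exact mul_ne_zero h₁ hv
    have hu : φ u ≠ 0 := by rw [e, map_mul] at hsv; exact right_ne_zero_of_mul hsv
    refine ⟨r₁ * v + r₂ * u, s₁ * v, hsv, ?_⟩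
    simp only [Prod.mk_add_mk, map_mul, map_add]
    rw [DivisionRing.mul_inv_add_mul_inv (hne hu) (hne hv) (by rw [← map_mul, e, map_mul]),
      DivisionRing.mul_inv_add_mul_inv hu hv (by rw [← map_mul, e, map_mul])]

/-- Working with the graph in D × E avoids choosing representatives of fractions: the homomorphism
is well defined as soon as a pair with first entry 0 has second entry 0. -/
theorem IsDivisionRingOfFractions.exists_specialization_of_divisionRing
    (hι : IsDivisionRingOfFractions ι)
    {π : A} (hker : ∀ r, φ r = 0 → ∃ r', r = r' * π)
    (hdiv : ∀ s, s ≠ 0 → ∃ (n : ℕ) (s' : A), φ s' ≠ 0 ∧ s = s' * π ^ n)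
    (hgen : ∀ Z : Subring E, (∀ r, φ r ∈ Z) → (∀ z z', z ∈ Z → z * z' = 1 → z' ∈ Z) → Z = ⊤) :
    ∃ ψ : RingSpecialization D E, ∀ r, ψ.MapsTo (ι r) (φ r) := by
  have hne {s : A} (h : φ s ≠ 0) : ι s ≠ 0 :=
    (map_ne_zero_iff ι hι.injective).2 fun h0 => h (by rw [h0, map_zero])
  let G : Subring (D × E) := fractionGraph (φ := φ) hι
    fun r s hs => hι.exists_ore (hι.exists_reduced hker hdiv) r hs
  have hG (r : A) : (ι r, φ r) ∈ G := ⟨r, 1, by simp, by simp⟩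
  have hinv (p : D × E) (hp : p ∈ G) (h2 : p.2 ≠ 0) : (p.1⁻¹, p.2⁻¹) ∈ G := by
    obtain ⟨r, s, hs, rfl⟩ := hp
    exact ⟨s, r, left_ne_zero_of_mul h2, by simp⟩
  have hG1 (p : D × E) (hp : p ∈ G) (h1 : p.1 = 0) : p.2 = 0 := by
    obtain ⟨r, s, hs, rfl⟩ := hp
    have : r = 0 := by
      by_contra hr
      exact mul_ne_zero ((map_ne_zero_iff ι hι.injective).2 hr) (inv_ne_zero (hne hs)) h1
    simp [this]
  let f : G →+* D := (RingHom.fst D E).comp G.subtype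
  have hf : Function.Injective f := by
    refine (injective_iff_map_eq_zero f).2 fun p hp => ?_
    exact Subtype.ext (Prod.ext hp (hG1 _ p.2 hp))
  let e : G ≃+* f.range := RingEquiv.ofBijective f.rangeRestrict
    ⟨fun x y h => hf (congrArg Subtype.val h), f.rangeRestrict_surjective⟩
  -- The specialization is the second projection composed with the inverse of the first. Its range
  -- is closed under inverses because swapping r and s inverts both entries, so `hgen` gives
  -- surjectivity.
  let g : G →+* E := (RingHom.snd D E).comp G.subtype
  have hsurj : g.range = ⊤ := by
    refine hgen _ (fun r => ⟨⟨_, hG r⟩, rfl⟩) ?_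
    rintro _ z' ⟨p, rfl⟩ hz
    have h2 : g p ≠ 0 := left_ne_zero_of_mul (hz ▸ one_ne_zero)
    refine ⟨⟨_, hinv p.1 p.2 h2⟩, ?_⟩
    exact inv_eq_of_mul_eq_one_right hz
  refine ⟨⟨⟨inferInstance, fun e he => isUnit_iff_ne_zero.2 he⟩, f.range,
    g.comp e.symm.toRingHom, ?_, ?_⟩, fun r => ⟨⟨⟨_, hG r⟩, rfl⟩, ?_⟩⟩
  · exact (RingHom.range_eq_top.1 hsurj).comp e.symm.surjective
  · intro t ht
    obtain ⟨p, rfl⟩ := e.surjective t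
    have h2 : g p ≠ 0 := by
      intro h
      exact ht (by rw [RingHom.mem_ker]; simpa using h)
    have h1 : p.1.1 ≠ 0 := by
      obtain ⟨r, s, hs, e⟩ := p.2
      have h2' : p.1.2 ≠ 0 := h2
      rw [e] at h2' ⊢
      exact mul_ne_zero (hne (left_ne_zero_of_mul h2')) (inv_ne_zero (hne hs))
    refine IsUnit.map e (isUnit_iff_exists.2 ⟨⟨_, hinv p.1 p.2 h2⟩, ?_, ?_⟩)
    · exact Subtype.ext (Prod.ext (mul_inv_cancel₀ h1) (mul_inv_cancel₀ h2))
    · exact Subtype.ext (Prod.ext (inv_mul_cancel₀ h1) (inv_mul_cancel₀ h2))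
  · change g (e.symm (e ⟨_, hG r⟩)) = _
    rw [e.symm_apply_apply]
    rfl

end Specialization

theorem IsDivisionRingOfFractions.exists_specialization {A D E : Type*} [Ring A] [DivisionRing D]
    [Ring E] {ι : A →+* D} (hι : IsDivisionRingOfFractions ι) (hE : RingIsDivision E)
    {φ : A →+* E} {π : A} (hker : ∀ r, φ r = 0 → ∃ r', r = r' * π)
    (hdiv : ∀ s, s ≠ 0 → ∃ (n : ℕ) (s' : A), φ s' ≠ 0 ∧ s = s' * π ^ n)
    (hgen : ∀ Z : Subring E, (∀ r, φ r ∈ Z) → (∀ z z', z ∈ Z → z * z' = 1 → z' ∈ Z) → Z = ⊤) :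
    ∃ ψ : RingSpecialization D E, ∀ r, ψ.MapsTo (ι r) (φ r) := by
  have := hE.nontrivial
  let _ : DivisionRing E := DivisionRing.ofIsUnitOrEqZero fun e =>
    (em (e = 0)).symm.imp_left (hE.isUnit_of_ne_zero e)
  exact hι.exists_specialization_of_divisionRing hker hdiv hgen

/-! ### The Ore condition and the existence of a division ring of fractions -/

open scoped Pointwise nonZeroDivisors

/-- A group algebra without zero divisors of a group with sufficiently invariant finite subsets
satisfies the right Ore condition. -/
theorem MonoidAlgebra.exists_mul_eq_mul_of_card_mul_lt {G k : Type*} [Group G] [Field k]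
    [DecidableEq G] [NoZeroDivisors (MonoidAlgebra k G)]
    (hG : ∀ F : Finset G, ∃ E : Finset G, (F * E).card < 2 * E.card)
    (a b : MonoidAlgebra k G) (hb : b ≠ 0) : ∃ u v, v ≠ 0 ∧ a * v = b * u := by
  obtain ⟨E, hE⟩ := hG (a.coeff.support ∪ b.coeff.support)
  set F := a.coeff.support ∪ b.coeff.support
  have hsupp (c : MonoidAlgebra k G) (hc : c.coeff.support ⊆ F) (v : G →₀ k)
      (hv : v ∈ Finsupp.supported k k (E : Set G)) :
      (c * MonoidAlgebra.ofCoeff v).coeff ∈ Finsupp.supported k k ((F * E : Finset G) : Set G) := by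
    rw [Finsupp.mem_supported] at hv ⊢
    norm_cast at hv ⊢
    exact (MonoidAlgebra.support_coeff_mul_subset _ _).trans (Finset.mul_subset_mul hc hv)
  let L (c : MonoidAlgebra k G) : (G →₀ k) →ₗ[k] (G →₀ k) :=
    (MonoidAlgebra.coeffLinearEquiv k).toLinearMap ∘ₗ LinearMap.mulLeft k c ∘ₗ
      (MonoidAlgebra.coeffLinearEquiv k).symm.toLinearMap
  let V := Finsupp.supported k k (E : Set G)
  let W := Finsupp.supported k k ((F * E : Finset G) : Set G)
  -- The map (v, u) ↦ a v + b u goes from dimension 2|E| to dimension |F E|, hence has a nonzero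
  -- kernel.
  let T : V × V →ₗ[k] W := LinearMap.coprod
    ((L a ∘ₗ V.subtype).codRestrict W fun v => hsupp a Finset.subset_union_left v v.2)
    ((L b ∘ₗ V.subtype).codRestrict W fun v => hsupp b Finset.subset_union_right v v.2)
  let eV : V ≃ₗ[k] ((E : Set G) →₀ k) := Finsupp.supportedEquivFinsupp _
  let eW : W ≃ₗ[k] (((F * E : Finset G) : Set G) →₀ k) := Finsupp.supportedEquivFinsupp _
  let T' := eW.toLinearMap ∘ₗ T ∘ₗ (eV.symm.toLinearMap.prodMap eV.symm.toLinearMap)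
  have hker : LinearMap.ker T' ≠ ⊥ := by
    apply LinearMap.ker_ne_bot_of_finrank_lt
    rw [Module.finrank_prod, Module.finrank_finsupp_self, Module.finrank_finsupp_self]
    simpa [← two_mul, -Finset.coe_mul] using hE
  obtain ⟨⟨v', u'⟩, hvu', hne'⟩ := Submodule.exists_mem_ne_zero_of_ne_bot hker
  obtain ⟨v, rfl⟩ := eV.surjective v'
  obtain ⟨u, rfl⟩ := eV.surjective u'
  have hvu : T (v, u) = 0 := by
    refine eW.injective (Eq.trans ?_ (map_zero eW).symm)
    simpa [T'] using hvu'
  have hne : (v, u) ≠ 0 := by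
    rintro h
    obtain ⟨rfl, rfl⟩ := Prod.mk_eq_zero.1 h
    simp at hne'
  have h : a * MonoidAlgebra.ofCoeff v.1 = b * -MonoidAlgebra.ofCoeff u.1 := by
    have h0 : (a * MonoidAlgebra.ofCoeff v.1).coeff + (b * MonoidAlgebra.ofCoeff u.1).coeff = 0 :=
      congrArg Subtype.val hvu
    rw [mul_neg, ← add_eq_zero_iff_eq_neg]
    exact MonoidAlgebra.coeff_injective h0
  -- If v = 0 then b u = 0, so u = 0 too, contradicting the choice of a nonzero kernel element.
  refine ⟨_, _, fun hv => hne ?_, h⟩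
  have hv0 : v = 0 := Subtype.ext (congrArg MonoidAlgebra.coeff hv)
  rw [hv, mul_zero] at h
  have hu := neg_eq_zero.1 ((mul_eq_zero.1 h.symm).resolve_left hb)
  have hu0 : u = 0 := Subtype.ext (congrArg MonoidAlgebra.coeff hu)
  rw [hv0, hu0]
  rfl

/-- A right Ore domain has a division ring of right fractions. -/
theorem exists_isDivisionRingOfFractions {A : Type u} [Ring A] [IsDomain A]
    (hore : ∀ a b : A, b ≠ 0 → ∃ u v, v ≠ 0 ∧ a * v = b * u) :
    ∃ (D : Type u) (_ : DivisionRing D) (ι : A →+* D), IsDivisionRingOfFractions ι := by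
  -- `OreLocalization` consists of left fractions, so right fractions of A are obtained from the
  -- opposite ring.
  have : Nonempty (OreLocalization.OreSet (Aᵐᵒᵖ)⁰) := by
    rw [OreLocalization.nonempty_oreSet_iff_of_noZeroDivisors]
    intro r s
    obtain ⟨u, v, hv, h⟩ := hore r.unop s.1.unop
      (by simp)
    refine ⟨MulOpposite.op u, ⟨MulOpposite.op v, mem_nonZeroDivisors_of_ne_zero (by simpa)⟩, ?_⟩
    exact MulOpposite.unop_injective h
  obtain ⟨_⟩ := this
  let N : Aᵐᵒᵖ →+* OreLocalization (Aᵐᵒᵖ)⁰ Aᵐᵒᵖ := OreLocalization.numeratorRingHom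
  have hN : Function.Injective N :=
    OreLocalization.numeratorHom_inj inf_le_left
  refine ⟨(OreLocalization (Aᵐᵒᵖ)⁰ Aᵐᵒᵖ)ᵐᵒᵖ, inferInstance,
    (RingHom.op N).comp (RingEquiv.opOp A).toRingHom, ?_, ?_⟩
  · intro x y h
    exact MulOpposite.op_injective (hN (MulOpposite.op_injective h))
  · intro d
    obtain ⟨d, rfl⟩ := MulOpposite.op_surjective d
    induction d using OreLocalization.ind with
    | _ r s =>
      have hs := nonZeroDivisors.ne_zero s.2
      refine ⟨r.unop, s.1.unop, by simp, ?_⟩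
      apply MulOpposite.unop_injective
      change r /ₒ s = (N s.1)⁻¹ * N r
      have hNs : N s.1 ≠ 0 := (map_ne_zero_iff N hN).2 hs
      rw [eq_inv_mul_iff_mul_eq₀ hNs]
      exact OreLocalization.mul_cancel

/-! ### The Heisenberg group in integer coordinates -/

open scoped Pointwise

/-- Integral Heisenberg coordinates; `⟨m, n, k⟩` stands for `x ^ m * y ^ n * [y, x] ^ k`. -/
@[ext]
structure HeisenbergTriple where
  m : ℤ
  n : ℤ
  k : ℤ

namespace HeisenbergTriple

/-- The cross term comes from moving y^n past x^m, which produces [y, x]^(nm). -/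
instance : Mul HeisenbergTriple := ⟨fun g h => ⟨g.m + h.m, g.n + h.n, g.k + h.k + g.n * h.m⟩⟩

instance : One HeisenbergTriple := ⟨⟨0, 0, 0⟩⟩

instance : Inv HeisenbergTriple := ⟨fun g => ⟨-g.m, -g.n, -g.k + g.n * g.m⟩⟩

theorem mul_def (g h : HeisenbergTriple) :
    g * h = ⟨g.m + h.m, g.n + h.n, g.k + h.k + g.n * h.m⟩ := rfl

theorem one_def : (1 : HeisenbergTriple) = ⟨0, 0, 0⟩ := rfl

theorem inv_def (g : HeisenbergTriple) : g⁻¹ = ⟨-g.m, -g.n, -g.k + g.n * g.m⟩ := rfl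

instance : Group HeisenbergTriple := Group.ofLeftAxioms
  (fun a b c => by ext <;> simp only [mul_def] <;> ring)
  (fun a => by ext <;> simp [mul_def, one_def])
  (fun a => by ext <;> simp [mul_def, one_def, inv_def])

theorem zpow_of_mul_eq_zero {g : HeisenbergTriple} (h : g.n * g.m = 0) (z : ℤ) :
    g ^ z = ⟨z * g.m, z * g.n, z * g.k⟩ := by
  let f : Multiplicative ℤ →* HeisenbergTriple :=
    { toFun := fun z => ⟨z.toAdd * g.m, z.toAdd * g.n, z.toAdd * g.k⟩
      map_one' := by simp [one_def]
      map_mul' := fun a b => by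
        ext <;> simp only [mul_def, toAdd_mul]
        · ring
        · ring
        · linear_combination -(a.toAdd * b.toAdd) * h }
  have h1 : f (Multiplicative.ofAdd 1) = g := by ext <;> simp [f]
  have h2 := map_zpow f (Multiplicative.ofAdd 1) z
  rw [h1, ← ofAdd_zsmul, smul_eq_mul, mul_one] at h2
  exact h2.symm

/-- The lexicographic coordinates. -/
def lexCoords (g : HeisenbergTriple) : ℤ ×ₗ ℤ ×ₗ ℤ := toLex (g.m, toLex (g.n, g.k))

theorem lexCoords_injective : Function.Injective lexCoords := by
  intro g h e
  simp only [lexCoords, EmbeddingLike.apply_eq_iff_eq, Prod.mk.injEq] at e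
  exact HeisenbergTriple.ext e.1 e.2.1 e.2.2

instance : LinearOrder HeisenbergTriple := LinearOrder.lift' lexCoords lexCoords_injective

theorem lt_iff (g h : HeisenbergTriple) :
    g < h ↔ g.m < h.m ∨ g.m = h.m ∧ (g.n < h.n ∨ g.n = h.n ∧ g.k < h.k) := by
  change lexCoords g < lexCoords h ↔ _
  simp [lexCoords, Prod.Lex.toLex_lt_toLex]

/-- The cross term depends only on the first coordinate of the right factor, so it is the same on
both sides whenever the last coordinate decides. -/
instance : MulLeftStrictMono HeisenbergTriple where
  elim g a b hab := by
    change a < b at hab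
    change g * a < g * b
    rw [lt_iff] at hab ⊢
    simp only [mul_def]
    rcases hab with h | ⟨h, h' | ⟨h', h''⟩⟩
    · exact .inl (by omega)
    · exact .inr ⟨by omega, .inl (by omega)⟩
    · exact .inr ⟨by omega, .inr ⟨by omega, by rw [h]; omega⟩⟩

/-- Finite boxes of coordinates. -/
def box (I J L : Finset ℤ) : Finset HeisenbergTriple :=
  (I ×ˢ J ×ˢ L).map ⟨fun p => ⟨p.1, p.2.1, p.2.2⟩, fun p q h => by
    simp only [mk.injEq] at h
    exact Prod.ext h.1 (Prod.ext h.2.1 h.2.2)⟩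

theorem mem_box {I J L : Finset ℤ} {g : HeisenbergTriple} :
    g ∈ box I J L ↔ g.m ∈ I ∧ g.n ∈ J ∧ g.k ∈ L := by
  simp only [box, Finset.mem_map, Finset.mem_product]
  constructor
  · rintro ⟨p, hp, rfl⟩
    exact hp
  · intro h
    exact ⟨(g.m, g.n, g.k), h, rfl⟩

theorem card_box (I J L : Finset ℤ) : (box I J L).card = I.card * (J.card * L.card) := by
  rw [box, Finset.card_map, Finset.card_product, Finset.card_product]

theorem exists_card_mul_lt (F : Finset HeisenbergTriple) :
    ∃ E : Finset HeisenbergTriple, (F * E).card < 2 * E.card := by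
  obtain ⟨d, hd0, hd⟩ : ∃ d : ℕ, 0 < d ∧ ∀ g ∈ F, |g.m| ≤ d ∧ |g.n| ≤ d ∧ |g.k| ≤ d := by
    refine ⟨(F.sup fun g => g.m.natAbs + g.n.natAbs + g.k.natAbs) + 1, by omega, fun g hg => ?_⟩
    have := Finset.le_sup (f := fun g : HeisenbergTriple =>
      g.m.natAbs + g.n.natAbs + g.k.natAbs) hg
    simp only [Int.abs_eq_natAbs]
    omega
  -- Left translation by F moves the first two coordinates by at most d and the third by at most d +
  -- dN. With sides 16 times these bounds each side grows by 18/16, and 18³ = 5832 < 8192 = 2 · 16³.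
  set N : ℕ := 16 * d with hN
  set M : ℕ := 16 * (d + d * N) with hM
  refine ⟨box (Finset.Ico 0 N) (Finset.Ico 0 N) (Finset.Ico 0 M), ?_⟩
  have hsub : F * box (Finset.Ico 0 N) (Finset.Ico 0 N) (Finset.Ico 0 M) ⊆
      box (Finset.Ico (-d) (N + d)) (Finset.Ico (-d) (N + d))
        (Finset.Ico (-(d + d * N : ℤ)) (M + (d + d * N))) := by
    intro z hz
    obtain ⟨g, hg, h, hh, rfl⟩ := Finset.mem_mul.1 hz
    obtain ⟨h1, h2, h3⟩ := hd g hg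
    simp only [mem_box, Finset.mem_Ico, mul_def] at hh ⊢
    obtain ⟨⟨e1, e2⟩, ⟨e3, e4⟩, e5, e6⟩ := hh
    rw [abs_le] at h1 h2 h3
    have hp : |g.n * h.m| ≤ d * N := by
      rw [abs_mul]
      exact mul_le_mul (abs_le.2 h2) (by rw [abs_of_nonneg e1]; exact e2.le) (abs_nonneg _)
        (by positivity)
    rw [abs_le] at hp
    refine ⟨⟨by omega, by omega⟩, ⟨by omega, by omega⟩, by linarith, by linarith⟩
  refine (Finset.card_le_card hsub).trans_lt ?_
  simp only [card_box, Int.card_Ico]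
  have a1 : ((N + d : ℤ) - -d).toNat = 18 * d := by omega
  have a2 : ((M + (d + d * N) : ℤ) - -(d + d * N)).toNat = 18 * (d + d * N) := by
    have : (M : ℤ) = 16 * (d + d * N) := by rw [hM]; push_cast; ring
    rw [this]
    have : (16 * (d + d * N) + (d + d * N) - -(d + d * N) : ℤ) =
      ((18 * (d + d * N) : ℕ) : ℤ) := by push_cast; ring
    rw [this, Int.toNat_natCast]
  rw [a1, a2]
  simp only [sub_zero, Int.toNat_natCast]
  rw [hM]
  have hpos : 0 < d * (d * (d + d * N)) := by positivity
  calc 18 * d * (18 * d * (18 * (d + d * N))) = 5832 * (d * (d * (d + d * N))) := by ring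
    _ < 8192 * (d * (d * (d + d * N))) := by omega
    _ = _ := by rw [hN]; ring

end HeisenbergTriple

/-- If `y x = x y c` with `c` central, then `y ^ n * x ^ m = x ^ m * y ^ n * c ^ (n * m)`. -/
theorem zpow_mul_zpow_of_mul_eq {G : Type*} [Group G] {x y c : G} (hx : Commute c x)
    (hy : Commute c y) (h : y * x = x * y * c) (m n : ℤ) :
    y ^ n * x ^ m = x ^ m * y ^ n * c ^ (n * m) := by
  have h1 : x⁻¹ * y ^ n * x = y ^ n * c ^ n := by
    have h0 : x⁻¹ * y * x⁻¹⁻¹ = y * c := by rw [inv_inv, mul_assoc, h]; group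
    have h2 := conj_zpow (i := n) (a := x⁻¹) (b := y)
    rw [h0, hy.symm.mul_zpow, inv_inv] at h2
    exact h2.symm
  have h2 : y ^ n * x * (y ^ n)⁻¹ = x * c ^ n := by
    rw [mul_inv_eq_iff_eq_mul, mul_assoc, (hy.zpow_zpow n n).eq, ← h1]
    group
  have h3 := conj_zpow (i := m) (a := y ^ n) (b := x)
  rw [h2, (hx.zpow_left n).symm.mul_zpow, eq_mul_inv_iff_mul_eq] at h3
  rw [← h3, mul_assoc, mul_assoc, ← zpow_mul, (hy.zpow_zpow (n * m) n).eq]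

namespace HeisenbergGroup

/-- The central generator `[y, x]`. -/
def c : HeisenbergGroup := groupComm y x

theorem groupComm_eq_one_iff {G : Type*} [Group G] {g h : G} :
    groupComm g h = 1 ↔ Commute g h := by
  rw [groupComm, mul_assoc, mul_assoc, inv_mul_eq_one, ← mul_right_inj h, mul_inv_cancel_left,
    eq_comm]
  rfl

theorem commute_c_x : Commute c x := by
  have h : groupComm x (groupComm x y) = 1 :=
    (PresentedGroup.one_of_mem (rels := heisenbergRels) (Set.mem_insert _ _) :)
  have e : c = (groupComm x y)⁻¹ := by simp only [c, groupComm]; group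
  rw [e]
  exact (groupComm_eq_one_iff.1 h).symm.inv_left

theorem commute_c_y : Commute c y := by
  have h : groupComm y (groupComm x y) = 1 :=
    (PresentedGroup.one_of_mem (rels := heisenbergRels) (Set.mem_insert_of_mem _ rfl) :)
  have e : c = (groupComm x y)⁻¹ := by simp only [c, groupComm]; group
  rw [e]
  exact (groupComm_eq_one_iff.1 h).symm.inv_left

theorem y_mul_x : y * x = x * y * c := by simp only [c, groupComm]; group

/-- The universal property of the Heisenberg group. -/
theorem exists_hom {G : Type*} [Group G] {g h : G} (hg : Commute g (groupComm g h))
    (hh : Commute h (groupComm g h)) : ∃ f : HeisenbergGroup →* G, f x = g ∧ f y = h := by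
  have hrel : ∀ r ∈ heisenbergRels, FreeGroup.lift ![g, h] r = 1 := by
    rintro r (rfl | rfl)
    · rw [← groupComm_eq_one_iff.2 hg]; simp [groupComm]
    · rw [← groupComm_eq_one_iff.2 hh]; simp [groupComm]
  exact ⟨PresentedGroup.toGroup hrel, PresentedGroup.toGroup.of hrel,
    PresentedGroup.toGroup.of hrel⟩

/-- The homomorphism `⟨m, n, k⟩ ↦ x ^ m * y ^ n * c ^ k`. -/
def ofTriple : HeisenbergTriple →* HeisenbergGroup where
  toFun g := x ^ g.m * y ^ g.n * c ^ g.k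
  map_one' := by simp [HeisenbergTriple.one_def]
  map_mul' g h := by
    have e := zpow_mul_zpow_of_mul_eq commute_c_x commute_c_y y_mul_x h.m g.n
    have c1 := (commute_c_x.zpow_zpow g.k h.m).eq
    have c2 := (commute_c_y.zpow_zpow g.k h.n).eq
    have c3 := (commute_c_y.zpow_zpow (g.n * h.m) h.n).eq
    simp only [HeisenbergTriple.mul_def, zpow_add]
    calc x ^ g.m * x ^ h.m * (y ^ g.n * y ^ h.n) * (c ^ g.k * c ^ h.k * c ^ (g.n * h.m))
        = x ^ g.m * (x ^ h.m * y ^ g.n * (y ^ h.n * c ^ (g.n * h.m))) * (c ^ g.k * c ^ h.k) := by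
          rw [← zpow_add c, (Commute.zpow_zpow (Commute.refl c) (g.k + h.k) (g.n * h.m)).eq]
          simp only [mul_assoc]
      _ = x ^ g.m * y ^ g.n * x ^ h.m * (y ^ h.n * c ^ g.k) * c ^ h.k := by
          rw [← c3, ← mul_assoc (x ^ h.m * y ^ g.n), ← e]
          simp only [mul_assoc]
      _ = x ^ g.m * y ^ g.n * (x ^ h.m * c ^ g.k) * y ^ h.n * c ^ h.k := by
          rw [← c2]
          simp only [mul_assoc]
      _ = _ := by
          rw [← c1]
          simp only [mul_assoc]

theorem ofTriple_apply (g : HeisenbergTriple) : ofTriple g = x ^ g.m * y ^ g.n * c ^ g.k := rfl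

/-- The universal property of the presentation supplies the inverse; the triples serve as a model
showing that x^m y^n c^k are distinct. -/
theorem ofTriple_bijective : Function.Bijective ofTriple := by
  obtain ⟨f, hfx, hfy⟩ := exists_hom (g := (⟨1, 0, 0⟩ : HeisenbergTriple)) (h := ⟨0, 1, 0⟩)
    (by simp [Commute, SemiconjBy, groupComm, HeisenbergTriple.mul_def, HeisenbergTriple.inv_def])
    (by simp [Commute, SemiconjBy, groupComm, HeisenbergTriple.mul_def, HeisenbergTriple.inv_def])
  have hfc : f c = ⟨0, 0, 1⟩ := by
    simp [c, groupComm, hfx, hfy, HeisenbergTriple.mul_def, HeisenbergTriple.inv_def]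
  refine Function.bijective_iff_has_inverse.2 ⟨f, fun g => ?_, fun g => ?_⟩
  · rw [ofTriple_apply, map_mul, map_mul, map_zpow, map_zpow, map_zpow, hfx, hfy, hfc,
      HeisenbergTriple.zpow_of_mul_eq_zero (by simp), HeisenbergTriple.zpow_of_mul_eq_zero (by simp),
      HeisenbergTriple.zpow_of_mul_eq_zero (by simp)]
    simp [HeisenbergTriple.mul_def]
  · have : ofTriple.comp f = MonoidHom.id _ := by
      refine PresentedGroup.ext fun n => ?_
      fin_cases n
      · change ofTriple (f x) = x
        simp [hfx, ofTriple_apply]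
      · change ofTriple (f y) = y
        simp [hfy, ofTriple_apply]
    exact DFunLike.congr_fun this g

/-- The Heisenberg group in coordinates. -/
noncomputable def equivTriple : HeisenbergTriple ≃* HeisenbergGroup :=
  MulEquiv.ofBijective ofTriple ofTriple_bijective

theorem uniqueProds : UniqueProds HeisenbergGroup :=
  UniqueProds.of_injective_mulHom equivTriple.symm.toMulHom equivTriple.symm.injective inferInstance

theorem exists_card_mul_lt [DecidableEq HeisenbergGroup] (F : Finset HeisenbergGroup) :
    ∃ E : Finset HeisenbergGroup, (F * E).card < 2 * E.card := by
  obtain ⟨E, hE⟩ := HeisenbergTriple.exists_card_mul_lt (F.image equivTriple.symm)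
  refine ⟨E.image equivTriple, ?_⟩
  have hF : (F.image equivTriple.symm).image equivTriple = F := by
    simp [Finset.image_image]
  have h := Finset.image_mul equivTriple (s := F.image equivTriple.symm) (t := E)
  rw [hF] at h
  rw [← h, Finset.card_image_of_injective _ equivTriple.injective,
    Finset.card_image_of_injective _ equivTriple.injective]
  exact hE

theorem exists_fractions (P : Type u) [Field P] :
    ∃ (D : Type u) (_ : DivisionRing D) (ι : MonoidAlgebra P HeisenbergGroup →+* D),
      IsDivisionRingOfFractions ι := by
  classical
  have := uniqueProds
  exact exists_isDivisionRingOfFractions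
    (MonoidAlgebra.exists_mul_eq_mul_of_card_mul_lt exists_card_mul_lt)

end HeisenbergGroup

/-! ### Normal forms in the group algebra over P[c] -/

open Polynomial

namespace HeisenbergGroup

section GroupAlgebra

variable (P : Type*) [Field P]

theorem commute_c (g : HeisenbergGroup) : Commute c g := by
  obtain ⟨t, rfl⟩ := ofTriple_bijective.surjective g
  rw [ofTriple_apply]
  exact ((commute_c_x.zpow_right _).mul_right (commute_c_y.zpow_right _)).mul_right
    ((Commute.refl c).zpow_right _)

/-- Evaluation of polynomials at the central element `c = [y, x]` of the group algebra. -/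
noncomputable def evalC : P[X] →+* MonoidAlgebra P HeisenbergGroup :=
  (aeval (MonoidAlgebra.of P HeisenbergGroup c)).toRingHom

theorem evalC_X : evalC P X = MonoidAlgebra.of P HeisenbergGroup c := by simp [evalC]

theorem evalC_mul_comm (p : P[X]) (r : MonoidAlgebra P HeisenbergGroup) :
    evalC P p * r = r * evalC P p := by
  have hc : MonoidAlgebra.of P HeisenbergGroup c * r = r * MonoidAlgebra.of P HeisenbergGroup c := by
    induction r using MonoidAlgebra.induction_linear with
    | zero => simp
    | add r s hr hs => rw [mul_add, add_mul, hr, hs]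
    | single g a => simp [MonoidAlgebra.of_apply, MonoidAlgebra.single_mul_single, (commute_c g).eq]
  induction p using Polynomial.induction_on with
  | C a => simpa [evalC] using Algebra.commutes a r
  | add p q hp hq => rw [map_add, add_mul, mul_add, hp, hq]
  | monomial n a h =>
    rw [pow_succ, ← mul_assoc, map_mul, mul_assoc, evalC_X, hc, ← mul_assoc, h, mul_assoc]

/-- The sums `∑ wₘₙ(c) xᵐ yⁿ` in the group algebra. -/
noncomputable abbrev normalForm : (ℕ × ℕ →₀ P[X]) →+ MonoidAlgebra P HeisenbergGroup :=
  skewEval (evalC P) (MonoidAlgebra.of P _ x) (MonoidAlgebra.of P _ y)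

theorem of_y_mul_of_x : MonoidAlgebra.of P HeisenbergGroup y * MonoidAlgebra.of P _ x =
    evalC P X * (MonoidAlgebra.of P _ x * MonoidAlgebra.of P _ y) := by
  rw [evalC_X, ← map_mul, ← map_mul, ← map_mul, y_mul_x, (commute_c _).eq]

variable {P}

/-- Up to the unit factors `xᴺ`, `yᴺ cᴺ` every element of the group algebra is a normal form. -/
theorem exists_normalForm_eq (r : MonoidAlgebra P HeisenbergGroup) :
    ∃ (N : ℕ) (w : ℕ × ℕ →₀ P[X]), normalForm P w =
      MonoidAlgebra.of P _ (x ^ N) * r * MonoidAlgebra.of P _ (y ^ N * c ^ N) := by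
  have hmul := exists_skewEval_eq_mul _ _ _ (evalC_mul_comm P) (of_y_mul_of_x P)
  have hx (n : ℕ) : ∃ w, normalForm P w = MonoidAlgebra.of P _ (x ^ n) :=
    ⟨Finsupp.single (n, 0) 1, by simp [normalForm, skewEval_single]⟩
  have hyc (n : ℕ) : ∃ w, normalForm P w = MonoidAlgebra.of P _ (y ^ n * c ^ n) := by
    refine ⟨Finsupp.single (0, n) (X ^ n), ?_⟩
    rw [normalForm, skewEval_single, map_pow, evalC_X, pow_zero, one_mul, ← map_pow, ← map_pow,
      ← map_mul, ((commute_c y).pow_pow n n).eq]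
  -- The shift N may be enlarged, so that two summands can use the same one.
  have mono (r : MonoidAlgebra P HeisenbergGroup) (N d : ℕ) (h : ∃ w, normalForm P w =
      MonoidAlgebra.of P _ (x ^ N) * r * MonoidAlgebra.of P _ (y ^ N * c ^ N)) :
      ∃ w, normalForm P w =
        MonoidAlgebra.of P _ (x ^ (N + d)) * r * MonoidAlgebra.of P _ (y ^ (N + d) * c ^ (N + d)) := by
    obtain ⟨w, hw⟩ := h
    obtain ⟨v₁, h₁⟩ := hx d
    obtain ⟨v₂, h₂⟩ := hyc d
    obtain ⟨w₁, e₁⟩ := hmul v₁ w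
    obtain ⟨w₂, e₂⟩ := hmul w₁ v₂
    refine ⟨w₂, ?_⟩
    have hc : (y ^ N * c ^ N) * (y ^ d * c ^ d) = y ^ (N + d) * c ^ (N + d) := by
      rw [pow_add, pow_add, mul_assoc, ← mul_assoc (c ^ N), ((commute_c y).pow_pow N d).eq]
      simp only [mul_assoc]
    rw [normalForm, e₂, e₁, hw, h₁, h₂, ← hc, add_comm, pow_add, map_mul _ (x ^ d),
      map_mul _ (y ^ N * c ^ N)]
    simp only [mul_assoc]
  induction r using MonoidAlgebra.induction_linear with
  | zero => exact ⟨0, 0, by simp⟩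
  | add r s hr hs =>
    obtain ⟨N, h⟩ := hr
    obtain ⟨N', h'⟩ := hs
    obtain ⟨w, hw⟩ := mono r N N' h
    obtain ⟨w', hw'⟩ := mono s N' N h'
    refine ⟨N + N', w + w', ?_⟩
    rw [map_add, hw, hw', mul_add, add_mul, add_comm N' N]
  | single g a =>
    obtain ⟨⟨m, n, k⟩, rfl⟩ := ofTriple_bijective.surjective g
    -- This N is large enough to make all three shifted exponents nonnegative.
    set N := m.natAbs + n.natAbs + k.natAbs with hN
    obtain ⟨m', hm⟩ : ∃ m' : ℕ, (N : ℤ) + m = m' := ⟨(N + m).toNat, by omega⟩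
    obtain ⟨n', hn⟩ : ∃ n' : ℕ, n + (N : ℤ) = n' := ⟨(n + N).toNat, by omega⟩
    obtain ⟨k', hk⟩ : ∃ k' : ℕ, k + (N : ℤ) = k' := ⟨(k + N).toNat, by omega⟩
    refine ⟨N, Finsupp.single (m', n') (C a * X ^ k'), ?_⟩
    have e : x ^ N * ofTriple ⟨m, n, k⟩ * (y ^ N * c ^ N) = c ^ k' * (x ^ m' * y ^ n') := by
      have h1 : (c ^ k' * (x ^ m' * y ^ n') : HeisenbergGroup) = x ^ m' * y ^ n' * c ^ k' :=
        ((commute_c _).pow_left k').eq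
      have h2 := ((commute_c y).zpow_zpow k N).eq
      rw [h1, ofTriple_apply]
      simp only [← zpow_natCast]
      rw [← hm, ← hn, ← hk, zpow_add, zpow_add, zpow_add]
      simp only [mul_assoc]
      rw [← mul_assoc (c ^ k), h2]
      simp only [mul_assoc]
    rw [normalForm, skewEval_single, map_mul, map_pow, evalC_X, ← map_pow, ← map_pow, ← map_pow,
      mul_assoc, ← map_mul, ← map_mul, ← e]
    simp [evalC, MonoidAlgebra.of_apply, MonoidAlgebra.single_mul_single]

end GroupAlgebra

/-! ### The map to the symbol algebra and divisibility by the minimal polynomial -/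

section Symbol

open SymbolAlgebra

variable {P K : Type*} [Field P] [Field K] [Algebra P K] {q : ℕ} {ζ : K}

theorem exists_hom_generic (hq : q ≠ 0) (hζ : ζ ^ q = 1) :
    ∃ φ : MonoidAlgebra P HeisenbergGroup →+* Generic K q ζ,
      φ (MonoidAlgebra.of P _ x) = i ∧ φ (MonoidAlgebra.of P _ y) = j ∧
      ∀ p : P[X], φ (evalC P p) = Generic.const K q ζ (aeval ζ p) := by
  have hζ0 : ζ ≠ 0 := by
    rintro rfl
    simp [hq] at hζ
  have ha : RatFunc₂.a K ≠ 0 := by simp [RatFunc₂.a]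
  have hb : RatFunc₂.b K ≠ 0 := by simp [RatFunc₂.b]
  obtain ⟨s, hs⟩ : IsUnit (i : Generic K q ζ) := isUnit_i hq ha.isUnit
  obtain ⟨t, ht⟩ : IsUnit (j : Generic K q ζ) := isUnit_j hq hb.isUnit
  let z : (Generic K q ζ)ˣ := Units.map (Generic.const K q ζ).toMonoidHom (Units.mk0 ζ hζ0)
  have hz (u : (Generic K q ζ)ˣ) : Commute z u := Units.ext (Generic.const_mul_comm ζ _)
  have hts : t * s = z * (s * t) := by
    apply Units.ext
    simp only [Units.val_mul, hs, ht]
    exact Generic.j_mul_i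
  have hzc : groupComm t s = z := by
    rw [groupComm, mul_assoc, hts, (hz _).eq]
    group
  have hzc' : groupComm s t = z⁻¹ := by
    rw [← hzc]; simp only [groupComm]; group
  obtain ⟨f, hfx, hfy⟩ := exists_hom (g := s) (h := t)
    (by rw [hzc']; exact (hz s).symm.inv_right) (by rw [hzc']; exact (hz t).symm.inv_right)
  have hfc : f c = z := by rw [← hzc, c, groupComm, groupComm]; simp [hfx, hfy]
  let φ : MonoidAlgebra P HeisenbergGroup →+* Generic K q ζ :=
    MonoidAlgebra.liftNCRingHom ((Generic.const K q ζ).comp (algebraMap P K))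
      ((Units.coeHom _).comp f) fun a g => Generic.const_mul_comm _ _
  have hφs (g a) : φ (MonoidAlgebra.single g a) =
      Generic.const K q ζ (algebraMap P K a) * (f g : Generic K q ζ) :=
    MonoidAlgebra.liftNC_single _ _ _ _
  have hφ (g) : φ (MonoidAlgebra.of P _ g) = f g := by
    rw [MonoidAlgebra.of_apply, hφs, map_one, map_one, one_mul]
  refine ⟨φ, by rw [hφ, hfx, hs], by rw [hφ, hfy, ht], fun p => ?_⟩
  have h : φ.comp (evalC P) = (Generic.const K q ζ).comp (aeval ζ : P[X] →ₐ[P] K).toRingHom := by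
    refine Polynomial.ringHom_ext (fun a => ?_) ?_
    · simp [evalC, hφs]
    · rw [RingHom.comp_apply, evalC_X, hφ, hfc]
      simp [z]
  exact RingHom.congr_fun h p

theorem exists_eq_smul_of_mapRange_aeval_eq_zero (hint : IsIntegral P ζ) {w : ℕ × ℕ →₀ P[X]}
    (h : w.mapRange (aeval ζ : P[X] →ₐ[P] K) (map_zero _) = 0) :
    ∃ w', w = minpoly P ζ • w' := by
  refine ⟨w.mapRange (fun p => p /ₘ minpoly P ζ) (zero_divByMonic _), ?_⟩
  ext1 p
  rw [Finsupp.smul_apply, Finsupp.mapRange_apply, smul_eq_mul]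
  have hdvd : minpoly P ζ ∣ w p := minpoly.dvd P ζ (DFunLike.congr_fun h p)
  have e := modByMonic_add_div (w p) (minpoly P ζ)
  rwa [(modByMonic_eq_zero_iff_dvd (minpoly.monic hint)).2 hdvd, zero_add, eq_comm] at e

/-- Each division by the minimal polynomial lowers the degree of one fixed nonzero coefficient, so
the process stops. -/
theorem exists_eq_pow_smul (hint : IsIntegral P ζ) {w : ℕ × ℕ →₀ P[X]} (hw : w ≠ 0) :
    ∃ (n : ℕ) (w' : ℕ × ℕ →₀ P[X]), w = minpoly P ζ ^ n • w' ∧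
      w'.mapRange (aeval ζ : P[X] →ₐ[P] K) (map_zero _) ≠ 0 := by
  obtain ⟨p, hp⟩ := Finsupp.ne_iff.1 hw
  rw [Finsupp.coe_zero, Pi.zero_apply] at hp
  induction hd : (w p).natDegree using Nat.strong_induction_on generalizing w with
  | _ d ih =>
    by_cases h : w.mapRange (aeval ζ : P[X] →ₐ[P] K) (map_zero _) = 0
    · obtain ⟨w', rfl⟩ := exists_eq_smul_of_mapRange_aeval_eq_zero hint h
      rw [Finsupp.smul_apply, smul_eq_mul] at hp hd
      have hp' := right_ne_zero_of_mul hp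
      have hlt : (w' p).natDegree < d := by
        rw [← hd, natDegree_mul (left_ne_zero_of_mul hp) hp']
        have := minpoly.natDegree_pos hint
        omega
      obtain ⟨n, v, e, hv⟩ := ih _ hlt (by rintro rfl; simp at hp') hp' rfl
      exact ⟨n + 1, v, by rw [pow_succ', mul_smul, ← e], hv⟩
    · exact ⟨0, w, by simp, h⟩

end Symbol

end HeisenbergGroup

/-! ### Generation of the symbol algebra and the specialization -/

namespace SymbolAlgebra

/-- A subring of the generic symbol algebra that is closed under inverses and contains the constants
and both generators is everything. -/
theorem Generic.subring_eq_top {K : Type*} [Field K] {q : ℕ} {ζ : K} (Z : Subring (Generic K q ζ))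
    (hZ : ∀ z z', z ∈ Z → z * z' = 1 → z' ∈ Z) (hc : ∀ k, Generic.const K q ζ k ∈ Z)
    (hi : i ∈ Z) (hj : j ∈ Z) : Z = ⊤ := by
  have hp (p : MvPolynomial (Fin 2) K) :
      algebraMap (RatFunc₂ K) (Generic K q ζ) (algebraMap _ _ p) ∈ Z := by
    induction p using MvPolynomial.induction_on with
    | C c => rw [RatFunc₂.algebraMap_C]; exact hc c
    | add p r hp hr => rw [map_add, map_add]; exact Z.add_mem hp hr
    | mul_X p n hp =>
      rw [map_mul, map_mul]
      refine Z.mul_mem hp ?_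
      fin_cases n
      · have := Z.pow_mem hi q
        rwa [i_pow_eq] at this
      · have := Z.pow_mem hj q
        rwa [j_pow_eq] at this
  rw [eq_top_iff]
  rintro s -
  induction s using SymbolAlgebra.induction with
  | scalar c =>
    obtain ⟨p, r, hr, rfl⟩ := IsFractionRing.div_surjective (A := MvPolynomial (Fin 2) K) c
    have hr0 : algebraMap (MvPolynomial (Fin 2) K) (RatFunc₂ K) r ≠ 0 := by
      simpa using nonZeroDivisors.ne_zero hr
    rw [div_eq_mul_inv, map_mul]
    refine Z.mul_mem (hp p) (hZ _ _ (hp r) ?_)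
    rw [← map_mul, mul_inv_cancel₀ hr0, map_one]
  | hi => exact hi
  | hj => exact hj
  | add s t hs ht => exact Z.add_mem hs ht
  | mul s t hs ht => exact Z.mul_mem hs ht

end SymbolAlgebra

open SymbolAlgebra in
/-- The division ring of fractions of the group algebra of the Heisenberg group specializes to the
generic symbol algebra over any field `K = P(ζ)` with `ζ ^ q = 1`. -/
theorem HeisenbergGroup.exists_specialization_generic {P K D : Type*} [Field P] [Field K]
    [Algebra P K] [DivisionRing D] {q : ℕ} {ζ : K} (hq : q ≠ 0) (hζ : ζ ^ q = 1)
    (hK : ∀ k : K, ∃ p : P[X], k = aeval ζ p) {ι : MonoidAlgebra P HeisenbergGroup →+* D}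
    (hι : IsDivisionRingOfFractions ι) :
    ∃ ψ : RingSpecialization D (Generic K q ζ),
      ψ.MapsTo (ι (MonoidAlgebra.of P _ x)) i ∧ ψ.MapsTo (ι (MonoidAlgebra.of P _ y)) j ∧
      ψ.MapsTo (ι (MonoidAlgebra.of P _ c)) (Generic.const K q ζ ζ) := by
  have hint : IsIntegral P ζ :=
    ⟨X ^ q - 1, monic_X_pow_sub_C (1 : P) hq, by simp [hζ]⟩
  have hdom := Generic.isDomain hq hζ
  obtain ⟨φ, hφx, hφy, hφp⟩ := exists_hom_generic (P := P) hq hζ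
  -- By independence of the monomials i^m j^n over constants, a normal form is killed exactly when
  -- every coefficient vanishes at ζ.
  have hφw (w : ℕ × ℕ →₀ P[X]) : φ (normalForm P w) = 0 ↔
      w.mapRange (aeval ζ : P[X] →ₐ[P] K) (map_zero _) = 0 := by
    have h := map_skewEval (evalC P) (MonoidAlgebra.of P _ x) (MonoidAlgebra.of P _ y)
      (Generic.const K q ζ) (aeval ζ : P[X] →ₐ[P] K).toRingHom φ hφp w
    rw [hφx, hφy] at h
    rw [normalForm, h, map_eq_zero_iff _ (Generic.skewEval_injective hq hζ)]
    rfl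
  have hunit (g : HeisenbergGroup) : MonoidAlgebra.of P _ g * MonoidAlgebra.of P _ g⁻¹ = 1 := by
    rw [← map_mul, mul_inv_cancel, map_one]
  have hunit' (g : HeisenbergGroup) : MonoidAlgebra.of P _ g⁻¹ * MonoidAlgebra.of P _ g = 1 := by
    rw [← map_mul, inv_mul_cancel, map_one]
  have hφu (g : HeisenbergGroup) : φ (MonoidAlgebra.of P _ g) ≠ 0 := by
    intro h
    have := congrArg φ (hunit g)
    rw [map_mul, h, zero_mul, map_one] at this
    exact zero_ne_one this
  have hnf (r : MonoidAlgebra P HeisenbergGroup) : ∃ (g h : HeisenbergGroup) (w : _),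
      r = MonoidAlgebra.of P _ g * normalForm P w * MonoidAlgebra.of P _ h := by
    obtain ⟨N, w, hw⟩ := exists_normalForm_eq r
    refine ⟨(x ^ N)⁻¹, (y ^ N * c ^ N)⁻¹, w, ?_⟩
    rw [hw, ← mul_assoc, ← mul_assoc, hunit', one_mul, mul_assoc, hunit, mul_one]
  -- Polynomials in c are central, so a common factor of the coefficients can be moved to the far
  -- right, as `hker` and `hdiv` require.
  have hpull (g h : HeisenbergGroup) (p : P[X]) (w : ℕ × ℕ →₀ P[X]) :
      MonoidAlgebra.of P _ g * normalForm P (p • w) * MonoidAlgebra.of P _ h =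
        MonoidAlgebra.of P _ g * normalForm P w * MonoidAlgebra.of P _ h * evalC P p := by
    rw [normalForm, skewEval_smul, evalC_mul_comm, ← mul_assoc, mul_assoc, evalC_mul_comm,
      ← mul_assoc]
  have hφg (g h : HeisenbergGroup) (w : ℕ × ℕ →₀ P[X]) :
      φ (MonoidAlgebra.of P _ g * normalForm P w * MonoidAlgebra.of P _ h) = 0 ↔
        w.mapRange (aeval ζ : P[X] →ₐ[P] K) (map_zero _) = 0 := by
    rw [map_mul, map_mul, mul_eq_zero, mul_eq_zero, hφw]
    simp only [hφu, false_or, or_false]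
  have hker (r) (hr : φ r = 0) : ∃ r', r = r' * evalC P (minpoly P ζ) := by
    obtain ⟨g, h, w, rfl⟩ := hnf r
    obtain ⟨w', rfl⟩ := exists_eq_smul_of_mapRange_aeval_eq_zero hint ((hφg _ _ _).1 hr)
    exact ⟨_, hpull _ _ _ _⟩
  have hdiv (s) (hs : s ≠ 0) :
      ∃ (n : ℕ) (s' : _), φ s' ≠ 0 ∧ s = s' * evalC P (minpoly P ζ) ^ n := by
    obtain ⟨g, h, w, rfl⟩ := hnf s
    have hw : w ≠ 0 := by
      rintro rfl
      simp at hs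
    obtain ⟨n, w', rfl, hw'⟩ := exists_eq_pow_smul hint hw
    exact ⟨n, _, fun h0 => hw' ((hφg _ _ _).1 h0), by rw [hpull, map_pow]⟩
  have hgen (Z : Subring (Generic K q ζ)) (hZφ : ∀ r, φ r ∈ Z)
      (hZ : ∀ z z', z ∈ Z → z * z' = 1 → z' ∈ Z) : Z = ⊤ := by
    refine Generic.subring_eq_top Z hZ (fun k => ?_) (hφx ▸ hZφ _) (hφy ▸ hZφ _)
    obtain ⟨p, rfl⟩ := hK k
    exact hφp p ▸ hZφ _
  obtain ⟨ψ, hψ⟩ := hι.exists_specialization (Generic.ringIsDivision hq hζ) hker hdiv hgen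
  refine ⟨ψ, hφx ▸ hψ _, hφy ▸ hψ _, ?_⟩
  have h := hφp X
  rw [evalC_X, aeval_X] at h
  exact h ▸ hψ _

theorem propositionP {P : Type u} [Field P] [Subsingleton (Subfield P)]
    {L : Type v} [Field L] [Algebra P L]
    (q : ℕ) (hq : 1 ≤ q) (hchar : ¬ ringChar P ∣ q) (θ : L) (hθ : IsPrimitiveRoot θ q) :
    (∃ (D : Type u) (_ : DivisionRing D) (ι : MonoidAlgebra P HeisenbergGroup →+* D),
      IsDivisionRingOfFractions ι) ∧
    ∀ (D : Type w) [DivisionRing D] (ι : MonoidAlgebra P HeisenbergGroup →+* D),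
      IsDivisionRingOfFractions ι →
      ∃ ψ : RingSpecialization D (GenericSymbolAlgebra P q θ),
        ψ.MapsTo (ι (MonoidAlgebra.of P _ HeisenbergGroup.x)) SymbolAlgebra.i ∧
        ψ.MapsTo (ι (MonoidAlgebra.of P _ HeisenbergGroup.y)) SymbolAlgebra.j ∧
        ψ.MapsTo
          (ι (MonoidAlgebra.of P _ (groupComm HeisenbergGroup.y HeisenbergGroup.x)))
          (algebraMap _ _ (rootInRatFunc₂ P θ)) := by
  refine ⟨HeisenbergGroup.exists_fractions P, fun D _ ι hι => ?_⟩
  have hq0 : q ≠ 0 := by omega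
  have hint : IsIntegral P θ :=
    ⟨X ^ q - 1, monic_X_pow_sub_C (1 : P) hq0, by simp [hθ.pow_eq_one]⟩
  have hζ : IntermediateField.AdjoinSimple.gen P θ ^ q = 1 :=
    Subtype.ext (by simpa using hθ.pow_eq_one)
  refine HeisenbergGroup.exists_specialization_generic hq0 hζ (fun k => ?_) hι
  -- As θ is algebraic, every element of P(θ) is a polynomial in θ.
  exact (IntermediateField.adjoin.powerBasis hint).exists_eq_aeval' k
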